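/- Let $M=\mathbb{R}/\mathbb{Z}\times\mathbb{R}$ be the cylinder with the flat Euclidean metric $\langle\cdot,\cdot\rangle$, norm $|\cdot|$ and universal cover $\mathbb{R}^2\to M$; every tangent space of $M$ is identified with $\mathbb{R}^2$, and $e_1=(1,0)$. A Finsler metric on $M$ is a function $F:TM\to\mathbb{R}$ that is $C^\infty$ off the zero section, non-negative, positively homogeneous ($F(av)=aF(v)$ for $a\ge 0$; $F(-v)=F(v)$ is not required) and strongly convex: there is $K\ge 1$ with $\frac{1}{K^2}|w|^2\le \frac{d^2}{dt^2}\big|_{t=0}\frac12F^2(v+tw)\le K^2|w|^2$ for all $v\ne 0$ and all $w$ in the same tangent space as $v$. Its lift to $\mathbb{R}^2$ is again denoted by $F$, and $d_F(x,y)$ is the infimum of the lengths $\int_0^1F(\dot\sigma)\,dt$ over all continuous, piecewise $C^1$ curves $\sigma:[0,1]\to\mathbb{R}^2$ with $\sigma(0)=x$ and $\sigma(1)=y$. A minimal geodesic of $(M,F)$ is a curve $c:\mathbb{R}\to M$ with a $C^1$ lift $\tilde c:\mathbb{R}\to\mathbb{R}^2$ such that $F(\dot{\tilde c}(t))=1$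 for all $t$ and $d_F(\tilde c(s),\tilde c(t))=t-s$ for all $s\le t$. **Theorem.** Let $c_F\in[1,\,1.016]$. Then there exists $\varepsilon>0$, depending only on $c_F$, such that for every Finsler metric $F$ on $M$ with $$\frac{1}{c_F}|v|\le F(v)\le c_F|v|\qquad\text{for all } v\in TM$$ there is a minimal geodesic $c:\mathbb{R}\to M$ of $(M,F)$ with $$\liminf_{T\to\infty}\frac1T\int_{-T}^0\langle\dot c(t),e_1\rangle\,dt\ \ge\ \varepsilon,\qquad \liminf_{T\to\infty}\frac1T\int_0^T\langle\dot c(t),e_1\rangle\,dt\ \ge\ \varepsilon .$$ -/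

import Mathlib

open scoped ContDiff

namespace CylinderFinsler

/-- The Euclidean plane, which is both the universal cover of the cylinder and
the model of each of its tangent spaces. -/
abbrev Plane : Type := EuclideanSpace ℝ (Fin 2)

/-- The cylinder `ℝ/ℤ × ℝ`. -/
abbrev Cylinder : Type := UnitAddCircle × ℝ

/-- The universal covering map `(x₁, x₂) ↦ (x₁ mod ℤ, x₂)`. -/
def proj (x : Plane) : Cylinder := ((x 0 : UnitAddCircle), x 1)

/-- The vector `e₁ = (1, 0)`. -/
noncomputable def e₁ : Plane := !₂[1, 0]

/-- A Finsler metric on the plane (with Euclidean background metric); `F x v` is the value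
of the metric at the tangent vector `v` with base point `x`. -/
structure IsFinslerMetric (F : Plane → Plane → ℝ) : Prop where
  smooth : ContDiffOn ℝ ∞ (fun p : Plane × Plane => F p.1 p.2) {p | p.2 ≠ 0}
  nonneg : ∀ x v, 0 ≤ F x v
  homogeneous : ∀ x v, ∀ a : ℝ, 0 ≤ a → F x (a • v) = a * F x v
  strongly_convex : ∃ K : ℝ, 1 ≤ K ∧ ∀ x v w : Plane, v ≠ 0 →
    1 / K ^ 2 * ‖w‖ ^ 2 ≤ iteratedDeriv 2 (fun t : ℝ => 1 / 2 * F x (v + t • w) ^ 2) 0 ∧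
    iteratedDeriv 2 (fun t : ℝ => 1 / 2 * F x (v + t • w) ^ 2) 0 ≤ K ^ 2 * ‖w‖ ^ 2

/-- The lift to the plane of a function on the tangent bundle `Cylinder × Plane` of the cylinder
(trivialised by the coordinate vector fields). -/
def lift (F : Cylinder → Plane → ℝ) : Plane → Plane → ℝ := fun x v => F (proj x) v

/-- A Finsler metric on the cylinder: since `proj` is a local isometry that respects the
trivialisations of the tangent bundles, all conditions can be read off on the lift. -/
def IsFinslerMetricOnCylinder (F : Cylinder → Plane → ℝ) : Prop :=
  IsFinslerMetric (lift F)

/-- `γ` is continuous and piecewise `C¹` on `[a, b]`. -/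
def IsPiecewiseC1 (γ : ℝ → Plane) (a b : ℝ) : Prop :=
  ContinuousOn γ (Set.Icc a b) ∧
  ∃ (n : ℕ) (t : ℕ → ℝ), Monotone t ∧ t 0 = a ∧ t n = b ∧
    ∀ i < n, ContDiffOn ℝ 1 γ (Set.Icc (t i) (t (i + 1)))

/-- The `F`-length of `γ` on `[a, b]`. -/
noncomputable def length (F : Plane → Plane → ℝ) (γ : ℝ → Plane) (a b : ℝ) : ℝ :=
  ∫ t in a..b, F (γ t) (deriv γ t)

/-- The `F`-distance, in general not symmetric. -/
noncomputable def dist (F : Plane → Plane → ℝ) (x y : Plane) : ℝ :=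
  sInf {l | ∃ γ : ℝ → Plane, IsPiecewiseC1 γ 0 1 ∧ γ 0 = x ∧ γ 1 = y ∧ l = length F γ 0 1}

/-- A minimal geodesic `ℝ → Plane`: a `C¹` curve, parametrised by `F`-arc length, each of whose
segments realises the `F`-distance from its initial point to its end point. -/
structure IsMinimalGeodesic (F : Plane → Plane → ℝ) (c : ℝ → Plane) : Prop where
  contDiff : ContDiff ℝ 1 c
  arcLength : ∀ t, F (c t) (deriv c t) = 1
  minimal : ∀ s t, s ≤ t → dist F (c s) (c t) = t - s

/-- `c` is a minimal geodesic of the cylinder with respect to `F` and `γ` is a lift of `c` to a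
minimal geodesic of the plane. In the trivialisation of the tangent bundle of the cylinder, the
velocity of `c` is `deriv γ`, whatever the choice of the lift. -/
def IsMinimalGeodesicWithLift (F : Cylinder → Plane → ℝ) (c : ℝ → Cylinder)
    (γ : ℝ → Plane) : Prop :=
  (∀ t, proj (γ t) = c t) ∧ IsMinimalGeodesic (lift F) γ

end CylinderFinsler

namespace CylinderFinsler

open Set MeasureTheory Filter Topology

/-! ### Piecewise `C¹` curves -/

/-! A shortest curve in the plane may run straight up the cylinder, so horizontal drift is forced by
a reward. Length minus `α * k` is minimised among curves climbing from height `-n` to height `n`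
with endpoint translated by `k • e₁`, where `α = 9 / 10`. As `c * α ≤ 1`, a translation costs
asymptotically no less than its reward, so the infimum is finite (`bddBelow_range_dist_sub`).

Almost minimisers, recentred at height 0, converge as `n → ∞` to a curve `σ` that realises distances
and satisfies `t - s ≤ dist F (σ s) (σ t + j • e₁) - α * j` for all integers `j`
(`exists_isometry`). If `σ` gained little in the direction `e₁`, shifting its endpoint to a chord of
slope about 1/2 would be cheaper once the reward is counted; for `c ≤ 1.016` this gives linear drift
(`horizontal_drift`).

The limit is a priori only Lipschitz. It is `C¹` because the distance agrees to second order with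
the norm frozen at a point (`exists_abs_sub_dist_le`) and `F ^ 2` is uniformly convex
(`exists_uniform_convexity`): consecutive steps of length `h` have directions differing by `O(√h)`,
so dyadic difference quotients converge uniformly. -/

theorem contDiffOn_Icc_of_le {γ : ℝ → Plane} {a b : ℝ} (h : b ≤ a) :
    ContDiffOn ℝ 1 γ (Icc a b) := by
  intro x hx
  have hs : Icc a b = {x} :=
    Subset.antisymm (fun y hy => le_antisymm (hy.2.trans (h.trans hx.1)) (hx.2.trans (h.trans hy.1)))
      (singleton_subset_iff.2 hx)
  rw [hs]
  exact (contDiffWithinAt_const (c := γ x)).congr (fun y hy => by rw [mem_singleton_iff.1 hy]) rfl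

namespace IsPiecewiseC1

variable {γ : ℝ → Plane} {a b : ℝ}

theorem of_contDiffOn (hab : a ≤ b) (h : ContDiffOn ℝ 1 γ (Icc a b)) : IsPiecewiseC1 γ a b := by
  refine ⟨h.continuousOn, 1, fun i => if i = 0 then a else b, ?_, by simp, by simp, ?_⟩
  · refine monotone_nat_of_le_succ fun i => ?_
    by_cases hi : i = 0 <;> simp [hi, hab]
  · intro i hi
    obtain rfl : i = 0 := by omega
    simpa using h

theorem le (h : IsPiecewiseC1 γ a b) : a ≤ b := by
  obtain ⟨-, n, t, ht, h0, hn, -⟩ := h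
  rw [← h0, ← hn]
  exact ht (Nat.zero_le _)

theorem mono (h : IsPiecewiseC1 γ a b) {s t : ℝ} (has : a ≤ s) (hst : s ≤ t) (htb : t ≤ b) :
    IsPiecewiseC1 γ s t := by
  obtain ⟨hc, n, τ, hτ, h0, hn, hp⟩ := h
  -- The old subdivision is clamped to `[s, t]`; pieces that collapse to a point are harmless.
  refine ⟨hc.mono (Icc_subset_Icc has htb), n, fun i => max s (min t (τ i)), ?_, ?_, ?_, ?_⟩
  · exact fun i j hij => max_le_max le_rfl (min_le_min le_rfl (hτ hij))
  · simp only [h0]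
    rw [min_eq_right (has.trans hst), max_eq_left has]
  · simp only [hn]
    rw [min_eq_left htb, max_eq_right hst]
  · intro i hi
    rcases le_or_gt (max s (min t (τ (i + 1)))) (max s (min t (τ i))) with hle | hlt
    · exact contDiffOn_Icc_of_le hle
    · refine (hp i hi).mono (Icc_subset_Icc ?_ ?_)
      · by_contra hcon
        push Not at hcon
        have h1 : s < τ i := by
          by_contra h'
          push Not at h'
          exact absurd hcon (not_lt.2 (h'.trans (le_max_left _ _)))
        have h2 : max s (min t (τ i)) = max s t := by
          rcases le_total t (τ i) with h3 | h3
          · rw [min_eq_left h3]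
          · rw [min_eq_right h3, max_eq_right h1.le] at hcon
            exact absurd hcon (lt_irrefl _)
        rw [h2] at hlt
        exact absurd hlt (not_lt.2 (max_le_max le_rfl (min_le_left _ _)))
      · by_contra hcon
        push Not at hcon
        rcases lt_max_iff.1 hcon with h1 | h1
        · have : max s (min t (τ (i + 1))) = s :=
            max_eq_left ((min_le_right _ _).trans h1.le)
          rw [this] at hlt
          exact absurd hlt (not_lt.2 (le_max_left _ _))
        · exact absurd h1 (not_lt.2 (min_le_right _ _))

theorem comp_mul_add {m k : ℝ} (hm : 0 < m) (h : IsPiecewiseC1 γ (m * a + k) (m * b + k)) :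
    IsPiecewiseC1 (fun u => γ (m * u + k)) a b := by
  obtain ⟨hc, n, τ, hτ, h0, hn, hp⟩ := h
  have key : ∀ x y : ℝ, MapsTo (fun u => m * u + k) (Icc ((x - k) / m) ((y - k) / m)) (Icc x y) := by
    intro x y u hu
    have h1 := (div_le_iff₀ hm).1 hu.1
    have h2 := (le_div_iff₀ hm).1 hu.2
    constructor <;> dsimp only <;> linarith
  have hinv : ∀ x : ℝ, (m * x + k - k) / m = x := fun x => by field_simp; ring
  have hsm : ContDiff ℝ 1 (fun u : ℝ => m * u + k) := by fun_prop
  refine ⟨?_, n, fun i => (τ i - k) / m, ?_, ?_, ?_, ?_⟩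
  · have := key (m * a + k) (m * b + k)
    rw [hinv, hinv] at this
    exact hc.comp hsm.continuous.continuousOn this
  · intro i j hij
    have := hτ hij
    dsimp only
    gcongr
  · simp only [h0, hinv]
  · simp only [hn, hinv]
  · intro i hi
    exact (hp i hi).comp hsm.contDiffOn (key _ _)

theorem congr {σ : ℝ → Plane} (h : IsPiecewiseC1 γ a b) (heq : EqOn σ γ (Icc a b)) :
    IsPiecewiseC1 σ a b := by
  obtain ⟨hc, n, τ, hτ, h0, hn, hp⟩ := h
  refine ⟨hc.congr heq, n, τ, hτ, h0, hn, fun i hi => (hp i hi).congr fun x hx => heq ?_⟩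
  rw [← h0, ← hn]
  exact ⟨(hτ (Nat.zero_le _)).trans hx.1, hx.2.trans (hτ hi)⟩

theorem trans {d : ℝ} (h : IsPiecewiseC1 γ a b) (h' : IsPiecewiseC1 γ b d) :
    IsPiecewiseC1 γ a d := by
  have hab := h.le
  have hbd := h'.le
  obtain ⟨hc, n, τ, hτ, h0, hn, hp⟩ := h
  obtain ⟨hc', n', τ', hτ', h0', hn', hp'⟩ := h'
  refine ⟨?_, n + n', fun i => if i < n then τ i else τ' (i - n), ?_, ?_, ?_, ?_⟩
  · rw [← Icc_union_Icc_eq_Icc hab hbd]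
    exact hc.union_of_isClosed hc' isClosed_Icc isClosed_Icc
  · refine monotone_nat_of_le_succ fun i => ?_
    by_cases h1 : i + 1 < n
    · simp only [h1, (by omega : i < n), if_true]
      exact hτ (Nat.le_succ i)
    · by_cases h2 : i < n
      · obtain rfl : n = i + 1 := by omega
        simp only [h2, if_true, lt_irrefl, if_false, Nat.sub_self, h0', ← hn]
        exact hτ (Nat.le_succ i)
      · simp only [h1, h2, if_false]
        exact hτ' (by omega)
  · dsimp only
    split_ifs with h1
    · exact h0
    · obtain rfl : n = 0 := by omega
      rw [← h0, hn, ← h0']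
  · simp [hn']
  · intro i hi
    dsimp only
    by_cases h1 : i + 1 < n
    · simp only [h1, (by omega : i < n), if_true]
      exact hp i (by omega)
    · by_cases h2 : i < n
      · obtain rfl : n = i + 1 := by omega
        simp only [h2, if_true, lt_irrefl, if_false, Nat.sub_self, h0', ← hn]
        exact hp i h2
      · simp only [h1, h2, if_false]
        have := hp' (i - n) (by omega)
        rwa [← Nat.sub_add_comm (by omega)] at this

/-- `deriv γ` is uncontrolled at the break points, but inside each piece it equals the one-sided
derivative, which is continuous up to the ends. -/
theorem intervalIntegrable_comp_deriv {E : Type*} [NormedAddCommGroup E] {Φ : Plane × Plane → E}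
    (hΦ : Continuous Φ) (h : IsPiecewiseC1 γ a b) :
    IntervalIntegrable (fun t => Φ (γ t, deriv γ t)) volume a b := by
  obtain ⟨-, n, τ, hτ, rfl, rfl, hp⟩ := h
  refine IntervalIntegrable.trans_iterate fun i hi => ?_
  rcases (hτ (Nat.le_succ i)).eq_or_lt with heq | hlt
  · rw [heq]
  · have hcont : ContinuousOn
        (fun t => Φ (γ t, derivWithin γ (Icc (τ i) (τ (i + 1))) t)) (Icc (τ i) (τ (i + 1))) :=
      hΦ.comp_continuousOn ((hp i hi).continuousOn.prodMk
        ((hp i hi).continuousOn_derivWithin (uniqueDiffOn_Icc hlt) le_rfl))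
    refine (hcont.intervalIntegrable_of_Icc hlt.le).congr_uIoo fun t ht => ?_
    rw [uIoo_of_le hlt.le] at ht
    dsimp only
    rw [derivWithin_of_mem_nhds (Icc_mem_nhds ht.1 ht.2)]

theorem intervalIntegrable_deriv (h : IsPiecewiseC1 γ a b) :
    IntervalIntegrable (deriv γ) volume a b :=
  h.intervalIntegrable_comp_deriv (Φ := Prod.snd) continuous_snd

theorem integral_deriv (h : IsPiecewiseC1 γ a b) : ∫ t in a..b, deriv γ t = γ b - γ a := by
  have hint : ∀ s t, a ≤ s → s ≤ t → t ≤ b → IntervalIntegrable (deriv γ) volume s t :=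
    fun s t h1 h2 h3 => (h.mono h1 h2 h3).intervalIntegrable_deriv
  obtain ⟨-, n, τ, hτ, rfl, rfl, hp⟩ := h
  rw [← intervalIntegral.sum_integral_adjacent_intervals fun i hi =>
    hint _ _ (hτ (Nat.zero_le _)) (hτ (Nat.le_succ i)) (hτ hi), ← Finset.sum_range_sub (fun i => γ (τ i))]
  exact Finset.sum_congr rfl fun i hi => intervalIntegral.integral_deriv_of_contDiffOn_Icc
    (hp i (Finset.mem_range.1 hi)) (hτ (Nat.le_succ i))

end IsPiecewiseC1

/-! ### Length and distance of a pinched metric -/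

theorem isPiecewiseC1_segment (x y : Plane) :
    IsPiecewiseC1 (fun t : ℝ => x + t • (y - x)) 0 1 :=
  .of_contDiffOn zero_le_one (by fun_prop)

theorem length_segment (F : Plane → Plane → ℝ) (x y : Plane) :
    length F (fun t : ℝ => x + t • (y - x)) 0 1 =
      ∫ t in (0 : ℝ)..1, F (x + t • (y - x)) (y - x) := by
  have hd : ∀ t : ℝ, deriv (fun t : ℝ => x + t • (y - x)) t = y - x := by
    intro t
    have : HasDerivAt (fun t : ℝ => x + t • (y - x)) ((1 : ℝ) • (y - x)) t :=
      ((hasDerivAt_id t).smul_const (y - x)).const_add x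
    simpa using this.deriv
  simp only [length, hd]

theorem exists_curve (F : Plane → Plane → ℝ) (x y : Plane) {η : ℝ} (hη : 0 < η) :
    ∃ γ : ℝ → Plane, IsPiecewiseC1 γ 0 1 ∧ γ 0 = x ∧ γ 1 = y ∧
      length F γ 0 1 < dist F x y + η := by
  have hne : {l | ∃ γ : ℝ → Plane, IsPiecewiseC1 γ 0 1 ∧ γ 0 = x ∧ γ 1 = y ∧
      l = length F γ 0 1}.Nonempty :=
    ⟨_, _, isPiecewiseC1_segment x y, by simp, by simp, rfl⟩
  obtain ⟨l, ⟨γ, h1, h2, h3, rfl⟩, hl⟩ :=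
    exists_lt_of_csInf_lt hne (lt_add_of_pos_right (dist F x y) hη)
  exact ⟨γ, h1, h2, h3, hl⟩

theorem length_congr (F : Plane → Plane → ℝ) {γ σ : ℝ → Plane} {a b : ℝ} (hab : a ≤ b) (heq : EqOn σ γ (Ioo a b)) :
    length F σ a b = length F γ a b := by
  refine intervalIntegral.integral_congr_uIoo fun t ht => ?_
  rw [uIoo_of_le hab] at ht
  have : σ =ᶠ[𝓝 t] γ := heq.eventuallyEq_of_mem (Ioo_mem_nhds ht.1 ht.2)
  rw [heq ht, this.deriv_eq]

/-- A Finsler metric on the plane that is `c`-equivalent to the Euclidean norm. -/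
structure IsPinched (F : Plane → Plane → ℝ) (c : ℝ) : Prop where
  finsler : IsFinslerMetric F
  one_le : 1 ≤ c
  lower : ∀ x v, ‖v‖ ≤ c * F x v
  upper : ∀ x v, F x v ≤ c * ‖v‖

namespace IsPinched

variable {F : Plane → Plane → ℝ} {c : ℝ} (hF : IsPinched F c)

include hF

theorem pos : 0 < c := zero_lt_one.trans_le hF.one_le

theorem nonneg (x v : Plane) : 0 ≤ F x v := hF.finsler.nonneg x v

theorem smul (x v : Plane) {a : ℝ} (ha : 0 ≤ a) : F x (a • v) = a * F x v :=
  hF.finsler.homogeneous x v a ha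

theorem zero (x : Plane) : F x 0 = 0 := by
  simpa using hF.smul x 0 (le_refl (0 : ℝ))

theorem continuous : Continuous (fun p : Plane × Plane => F p.1 p.2) := by
  rw [continuous_iff_continuousAt]
  rintro ⟨x, v⟩
  by_cases hv : v = 0
  · subst hv
    have h0 : Tendsto (fun p : Plane × Plane => c * ‖p.2‖) (𝓝 (x, 0)) (𝓝 0) := by
      have : Continuous (fun p : Plane × Plane => c * ‖p.2‖) := by fun_prop
      simpa using this.tendsto (x, 0)
    have : Tendsto (fun p : Plane × Plane => F p.1 p.2) (𝓝 (x, 0)) (𝓝 0) :=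
      squeeze_zero (fun p => hF.nonneg _ _) (fun p => hF.upper _ _) h0
    simpa [ContinuousAt, hF.zero x] using this
  · have hopen : IsOpen {p : Plane × Plane | p.2 ≠ 0} :=
      isOpen_ne_fun continuous_snd continuous_const
    exact (hF.finsler.smooth.continuousOn).continuousAt (hopen.mem_nhds hv)

theorem continuous_right (x : Plane) : Continuous (F x) :=
  hF.continuous.comp (Continuous.prodMk continuous_const continuous_id)

variable {γ : ℝ → Plane} {a b : ℝ}

theorem intervalIntegrable_length (h : IsPiecewiseC1 γ a b) :
    IntervalIntegrable (fun t => F (γ t) (deriv γ t)) volume a b :=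
  h.intervalIntegrable_comp_deriv hF.continuous

theorem length_nonneg (h : a ≤ b) : 0 ≤ length F γ a b :=
  intervalIntegral.integral_nonneg h fun _ _ => hF.nonneg _ _

theorem bddBelow (x y : Plane) : BddBelow
    {l | ∃ γ : ℝ → Plane, IsPiecewiseC1 γ 0 1 ∧ γ 0 = x ∧ γ 1 = y ∧ l = length F γ 0 1} := by
  refine ⟨0, ?_⟩
  rintro l ⟨γ, -, -, -, rfl⟩
  exact hF.length_nonneg zero_le_one

theorem length_comp_mul_add {m : ℝ} (hm : 0 < m) (k : ℝ) :
    length F (fun u => γ (m * u + k)) a b = length F γ (m * a + k) (m * b + k) := by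
  have hd : ∀ u, deriv (fun u => γ (m * u + k)) u = m • deriv γ (m * u + k) := by
    intro u
    rw [deriv_comp_mul_left m (fun x => γ (x + k)) u, deriv_comp_add_const]
  unfold length
  rw [← intervalIntegral.smul_integral_comp_mul_add, smul_eq_mul,
    ← intervalIntegral.integral_const_mul]
  refine intervalIntegral.integral_congr fun u _ => ?_
  rw [hd, hF.smul _ _ hm.le]

theorem length_add {s : ℝ} (h : IsPiecewiseC1 γ a b) (h1 : a ≤ s) (h2 : s ≤ b) :
    length F γ a s + length F γ s b = length F γ a b :=
  intervalIntegral.integral_add_adjacent_intervals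
    (hF.intervalIntegrable_length (h.mono le_rfl h1 h2))
    (hF.intervalIntegrable_length (h.mono h1 h2 le_rfl))

theorem dist_self_le (x : Plane) : dist F x x ≤ 0 := by
  refine csInf_le (hF.bddBelow x x) ⟨fun _ => x, ?_, rfl, rfl, ?_⟩
  · exact .of_contDiffOn zero_le_one contDiffOn_const
  · simp [length, hF.zero]

theorem dist_le_length (h : IsPiecewiseC1 γ a b) : dist F (γ a) (γ b) ≤ length F γ a b := by
  rcases h.le.eq_or_lt with rfl | hlt
  · simpa [length] using hF.dist_self_le (γ a)
  · have hm : 0 < b - a := sub_pos.2 hlt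
    have h0 : (b - a) * 0 + a = a := by ring
    have h1 : (b - a) * 1 + a = b := by ring
    refine csInf_le (hF.bddBelow _ _) ⟨fun u => γ ((b - a) * u + a), ?_, ?_, ?_, ?_⟩
    · exact IsPiecewiseC1.comp_mul_add hm (by rwa [h0, h1])
    · simp only [h0]
    · simp only [h1]
    · rw [hF.length_comp_mul_add hm, h0, h1]

theorem dist_le_segment (x y : Plane) :
    dist F x y ≤ ∫ t in (0 : ℝ)..1, F (x + t • (y - x)) (y - x) := by
  have := hF.dist_le_length (isPiecewiseC1_segment x y)
  rw [length_segment] at this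
  simpa using this

theorem dist_triangle (x y z : Plane) : dist F x z ≤ dist F x y + dist F y z := by
  refine le_of_forall_pos_le_add fun η hη => ?_
  obtain ⟨γ₁, h₁, h₁0, h₁1, hl₁⟩ := exists_curve F x y (half_pos hη)
  obtain ⟨γ₂, h₂, h₂0, h₂1, hl₂⟩ := exists_curve F y z (half_pos hη)
  have hγ₂ : IsPiecewiseC1 (fun t => γ₂ (1 * t + (-1))) 1 2 :=
    IsPiecewiseC1.comp_mul_add zero_lt_one (by norm_num; exact h₂)
  let σ : ℝ → Plane := fun t => if t ≤ 1 then γ₁ t else γ₂ (1 * t + (-1))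
  have e₁ : EqOn σ γ₁ (Icc 0 1) := fun t ht => if_pos ht.2
  have e₂ : EqOn σ (fun t => γ₂ (1 * t + (-1))) (Icc 1 2) := by
    intro t ht
    rcases ht.1.eq_or_lt with rfl | hlt
    · simp [σ, h₁1, h₂0]
    · exact if_neg (not_le.2 hlt)
  have hσ : IsPiecewiseC1 σ 0 2 := (h₁.congr e₁).trans (hγ₂.congr e₂)
  have hd := hF.dist_le_length hσ
  rw [← hF.length_add hσ zero_le_one one_le_two,
    length_congr F zero_le_one (e₁.mono Ioo_subset_Icc_self),
    length_congr F one_le_two (e₂.mono Ioo_subset_Icc_self),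
    hF.length_comp_mul_add zero_lt_one] at hd
  have hσ0 : σ 0 = x := by rw [e₁ (by simp), h₁0]
  have hσ2 : σ 2 = z := by
    rw [e₂ (by simp), ← h₂1]
    norm_num
  rw [hσ0, hσ2] at hd
  norm_num at hd
  linarith

theorem integral_norm_deriv_le (h : IsPiecewiseC1 γ a b) :
    ∫ t in a..b, ‖deriv γ t‖ ≤ c * length F γ a b := by
  unfold length
  rw [← intervalIntegral.integral_const_mul]
  exact intervalIntegral.integral_mono_on h.le h.intervalIntegrable_deriv.norm
    ((hF.intervalIntegrable_length h).const_mul c) fun t _ => hF.lower _ _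

theorem norm_sub_le_length (h : IsPiecewiseC1 γ a b) :
    ‖γ b - γ a‖ ≤ c * length F γ a b := by
  rw [← h.integral_deriv]
  exact (intervalIntegral.norm_integral_le_integral_norm h.le).trans (hF.integral_norm_deriv_le h)

theorem norm_sub_le_dist (x y : Plane) : ‖y - x‖ ≤ c * dist F x y := by
  refine le_of_forall_pos_le_add fun η hη => ?_
  obtain ⟨γ, h, rfl, rfl, hl⟩ := exists_curve F x y (div_pos hη hF.pos)
  refine (hF.norm_sub_le_length h).trans ?_
  have := mul_le_mul_of_nonneg_left hl.le hF.pos.le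
  rwa [mul_add, mul_div_cancel₀ _ hF.pos.ne'] at this

theorem intervalIntegrable_segment (x v w : Plane) :
    IntervalIntegrable (fun t : ℝ => F (x + t • v) w) volume 0 1 :=
  (hF.continuous.comp (by fun_prop :
    Continuous fun t : ℝ => ((x + t • v, w) : Plane × Plane))).intervalIntegrable _ _

theorem dist_le_norm (x y : Plane) : dist F x y ≤ c * ‖y - x‖ := by
  refine (hF.dist_le_segment x y).trans ?_
  calc _ ≤ ∫ _t in (0 : ℝ)..1, c * ‖y - x‖ :=
        intervalIntegral.integral_mono_on zero_le_one (hF.intervalIntegrable_segment _ _ _)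
          (by simp) fun t _ => hF.upper _ _
    _ = _ := by simp

theorem dist_nonneg (x y : Plane) : 0 ≤ dist F x y :=
  nonneg_of_mul_nonneg_right ((norm_nonneg _).trans (hF.norm_sub_le_dist x y)) hF.pos

theorem continuous_dist : Continuous (fun p : Plane × Plane => dist F p.1 p.2) := by
  rw [continuous_iff_continuousAt]
  rintro ⟨x, y⟩
  have h0 : Tendsto (fun p : Plane × Plane => c * ‖p.1 - x‖ + c * ‖p.2 - y‖) (𝓝 (x, y)) (𝓝 0) := by
    have : Continuous (fun p : Plane × Plane => c * ‖p.1 - x‖ + c * ‖p.2 - y‖) := by fun_prop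
    simpa using this.tendsto (x, y)
  refine tendsto_iff_norm_sub_tendsto_zero.2 (squeeze_zero (fun p => norm_nonneg _) (fun p => ?_) h0)
  obtain ⟨x', y'⟩ := p
  have h1 := hF.dist_triangle x x' y
  have h2 := hF.dist_triangle x' y' y
  have h3 := hF.dist_triangle x' x y'
  have h4 := hF.dist_triangle x y y'
  have h5 := hF.dist_le_norm x x'
  have h6 := hF.dist_le_norm y' y
  have h7 := hF.dist_le_norm x' x
  have h8 := hF.dist_le_norm y y'
  rw [norm_sub_rev] at h6 h7
  rw [Real.norm_eq_abs, abs_le]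
  dsimp only
  constructor <;> linarith

theorem dist_translate_le {w : Plane} (hw : ∀ x v, F (x + w) v = F x v) (x y : Plane) :
    dist F (x + w) (y + w) ≤ dist F x y := by
  refine le_of_forall_pos_le_add fun η hη => ?_
  obtain ⟨γ, h, rfl, rfl, hl⟩ := exists_curve F x y hη
  have hσ : IsPiecewiseC1 (fun t => γ t + w) 0 1 := by
    obtain ⟨hc, n, τ, hτ, h0, hn, hp⟩ := h
    exact ⟨hc.add continuousOn_const, n, τ, hτ, h0, hn, fun i hi => (hp i hi).add contDiffOn_const⟩
  refine (hF.dist_le_length hσ).trans (le_trans (le_of_eq ?_) hl.le)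
  simp only [length, deriv_add_const, hw]

end IsPinched

/-! ### Triangle inequality and uniform convexity of the norms `F x` -/

namespace IsPinched

variable {F : Plane → Plane → ℝ} {c : ℝ} (hF : IsPinched F c)

include hF

/-- Restarting the strong convexity hypothesis at each point of the segment bounds the second
derivative of `F ^ 2 / 2` below by a constant. The segment must miss the origin, where `F ^ 2` need
not be twice differentiable. -/
theorem convexOn_segment {K : ℝ}
    (hK : ∀ x v w : Plane, v ≠ 0 → 1 / K ^ 2 * ‖w‖ ^ 2 ≤
      iteratedDeriv 2 (fun t : ℝ => 1 / 2 * F x (v + t • w) ^ 2) 0)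
    {x v w : Plane} (h0 : ∀ t ∈ Icc (0 : ℝ) 1, v + t • w ≠ 0) :
    ConvexOn ℝ (Icc 0 1) (fun t : ℝ => 1 / 2 * F x (v + t • w) ^ 2 -
      1 / 2 * (1 / K ^ 2 * ‖w‖ ^ 2) * t ^ 2) := by
  set m : ℝ := 1 / K ^ 2 * ‖w‖ ^ 2 with hm
  set U : Set ℝ := {t | v + t • w ≠ 0} with hU
  have hUo : IsOpen U := isOpen_ne_fun (by fun_prop) continuous_const
  set g : ℝ → ℝ := fun t => 1 / 2 * F x (v + t • w) ^ 2 with hg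
  have hgs : ContDiffOn ℝ ∞ g U := by
    have h1 : ContDiff ℝ ∞ (fun t : ℝ => ((x, v + t • w) : Plane × Plane)) := by fun_prop
    exact contDiffOn_const.mul
      ((hF.finsler.smooth.comp h1.contDiffOn (fun t ht => ht)).pow 2)
  have hg2 : ∀ t ∈ U, ContDiffAt ℝ ∞ g t := fun t ht => hgs.contDiffAt (hUo.mem_nhds ht)
  have hq2 : ∀ t : ℝ, ContDiffAt ℝ ∞ (fun t : ℝ => 1 / 2 * m * t ^ 2) t := fun t => by fun_prop
  have hf2 : ∀ t ∈ U, ContDiffAt ℝ ∞ (fun t => g t - 1 / 2 * m * t ^ 2) t := fun t ht =>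
    (hg2 t ht).sub (hq2 t)
  have hfs : ContDiffOn ℝ ∞ (fun t => g t - 1 / 2 * m * t ^ 2) U := fun t ht =>
    (hf2 t ht).contDiffWithinAt
  refine convexOn_of_deriv2_nonneg' (convex_Icc 0 1) ?_ ?_ ?_
  · exact (hfs.mono h0).differentiableOn (by simp)
  · exact ((hfs.deriv_of_isOpen (m := 1) hUo (by norm_cast)).mono h0).differentiableOn (by simp)
  · intro t ht
    rw [← iteratedDeriv_eq_iterate, iteratedDeriv_fun_sub
      ((hg2 t (h0 t ht)).of_le (by norm_cast)) ((hq2 t).of_le (by norm_cast))]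
    have hq : iteratedDeriv 2 (fun t : ℝ => 1 / 2 * m * t ^ 2) t = m := by
      have h1 : deriv (fun t : ℝ => 1 / 2 * m * t ^ 2) = fun t => m * t := by
        funext s
        simp
        ring
      rw [iteratedDeriv_succ, iteratedDeriv_one, h1]
      simp
    have hgt : iteratedDeriv 2 (fun s : ℝ => 1 / 2 * F x ((v + t • w) + s • w) ^ 2) 0 =
        iteratedDeriv 2 g t := by
      have h1 : (fun s : ℝ => 1 / 2 * F x ((v + t • w) + s • w) ^ 2) = fun s => g (t + s) := by
        funext s
        simp only [hg, add_smul, add_assoc]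
      rw [h1, iteratedDeriv_comp_const_add]
      simp
    have := hK x (v + t • w) w (h0 t ht)
    rw [hgt, ← hm] at this
    rw [hq]
    linarith

/-- Covers the segments through the origin: for opposite vectors the sum is a shrunken copy of one
of them. -/
theorem add_le_of_neg {x v w : Plane} {l : ℝ} (hl : 0 ≤ l) (hv : v = -l • w) :
    F x (v + w) ≤ max (F x v) (F x w) := by
  rcases le_total l 1 with h1 | h1
  · have : v + w = (1 - l) • w := by rw [hv]; module
    rw [this, hF.smul _ _ (by linarith)]
    refine le_trans ?_ (le_max_right _ _)
    nlinarith [hF.nonneg x w]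
  · have hl0 : 0 < l := by linarith
    have : v + w = (1 - 1 / l) • v := by
      rw [hv]
      have : (1 - 1 / l) • (-l) • w = ((1 - 1 / l) * -l) • w := smul_smul _ _ _
      rw [this, show (1 - 1 / l) * -l = -l + 1 by field_simp; ring]
      module
    have h2 : 1 / l ≤ 1 := by rw [div_le_one hl0]; exact h1
    have h3 : 0 < 1 / l := by positivity
    rw [this, hF.smul _ _ (by linarith)]
    refine le_trans ?_ (le_max_left _ _)
    nlinarith [hF.nonneg x v]

omit hF in
theorem segment_cases {v w : Plane} (hw : w ≠ 0) :
    (∃ l : ℝ, 0 ≤ l ∧ v = -l • w) ∨ ∀ t ∈ Icc (0 : ℝ) 1, v + t • (w - v) ≠ 0 := by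
  by_cases h : ∀ t ∈ Icc (0 : ℝ) 1, v + t • (w - v) ≠ 0
  · exact .inr h
  · push Not at h
    obtain ⟨t, ht, h0⟩ := h
    have h1 : t ≠ 1 := by
      rintro rfl
      apply hw
      simpa using h0
    have h2 : 0 < 1 - t := sub_pos.2 (lt_of_le_of_ne ht.2 h1)
    refine .inl ⟨t / (1 - t), div_nonneg ht.1 h2.le, ?_⟩
    have h3 : (1 - t) • v = -t • w := by
      rw [← sub_eq_zero, ← h0]
      module
    have h4 : v = (1 - t)⁻¹ • (1 - t) • v := by rw [inv_smul_smul₀ h2.ne']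
    rw [h4, h3, smul_smul]
    congr 1
    field_simp

theorem eq_zero_of_le {x v : Plane} (h : F x v ≤ 0) : v = 0 := by
  have h1 := hF.lower x v
  have h2 : c * F x v ≤ 0 := mul_nonpos_of_nonneg_of_nonpos hF.pos.le h
  exact norm_le_zero_iff.1 (h1.trans h2)

/-- After rescaling to `F`-unit vectors, `v + w` is `F x v + F x w` times a point on the segment
between them, and convexity of `F ^ 2` puts that point in the unit ball. -/
theorem add_le (x v w : Plane) : F x (v + w) ≤ F x v + F x w := by
  by_cases hv : v = 0
  · simp [hv, hF.zero]
  by_cases hw : w = 0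
  · simp [hw, hF.zero]
  rcases segment_cases (v := v) hw with ⟨l, hl, hvw⟩ | -
  · exact (hF.add_le_of_neg hl hvw).trans (max_le_add_of_nonneg (hF.nonneg _ _) (hF.nonneg _ _))
  obtain ⟨K, -, hK⟩ := hF.finsler.strongly_convex
  have ha : 0 < F x v := by
    by_contra h
    exact hv (hF.eq_zero_of_le (not_lt.1 h))
  have hb : 0 < F x w := by
    by_contra h
    exact hw (hF.eq_zero_of_le (not_lt.1 h))
  set a := F x v
  set b := F x w
  set v' := a⁻¹ • v with hv'
  set w' := b⁻¹ • w with hw'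
  have hFv : F x v' = 1 := by rw [hF.smul _ _ (inv_pos.2 ha).le]; exact inv_mul_cancel₀ ha.ne'
  have hFw : F x w' = 1 := by rw [hF.smul _ _ (inv_pos.2 hb).le]; exact inv_mul_cancel₀ hb.ne'
  have hw0 : w' ≠ 0 := smul_ne_zero (inv_pos.2 hb).ne' hw
  have hsum : v + w = (a + b) • (v' + (b / (a + b)) • (w' - v')) := by
    have h1 : v = a • v' := by rw [hv', smul_inv_smul₀ ha.ne']
    have h2 : w = b • w' := by rw [hw', smul_inv_smul₀ hb.ne']
    have h3 : (a + b) • (v' + (b / (a + b)) • (w' - v')) =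
        (a + b - (a + b) * (b / (a + b))) • v' + ((a + b) * (b / (a + b))) • w' := by module
    rw [h3, mul_div_cancel₀ _ (by positivity)]
    rw [add_sub_cancel_right, ← h1, ← h2]
  rcases segment_cases (v := v') hw0 with ⟨l, hl, hvw⟩ | hseg
  · have hv2 : v = -(l * a / b) • w := by
      have h1 : v = a • v' := by rw [hv', smul_inv_smul₀ ha.ne']
      rw [h1, hvw, hw', smul_smul, smul_smul]
      congr 1
      ring
    exact (hF.add_le_of_neg (by positivity) hv2).trans
      (max_le_add_of_nonneg (hF.nonneg _ _) (hF.nonneg _ _))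
  · have hconv := hF.convexOn_segment (fun x v w hv => (hK x v w hv).1) hseg (x := x)
    set θ := b / (a + b) with hθ
    have hθ0 : 0 ≤ θ := by positivity
    have hθ1 : θ ≤ 1 := by rw [hθ, div_le_one (by positivity)]; linarith
    have := hconv.2 (left_mem_Icc.2 zero_le_one) (right_mem_Icc.2 zero_le_one)
      (sub_nonneg.2 hθ1) hθ0 (by ring)
    simp only [smul_eq_mul, mul_zero, mul_one, zero_add, zero_smul, add_zero, one_smul,
      add_sub_cancel, hFv, hFw] at this
    have hm : 0 ≤ 1 / K ^ 2 * ‖w' - v'‖ ^ 2 := by positivity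
    have hF1 : F x (v' + θ • (w' - v')) ≤ 1 := by
      have : F x (v' + θ • (w' - v')) ^ 2 ≤ 1 := by
        nlinarith [mul_nonneg hm (mul_nonneg hθ0 (sub_nonneg.2 hθ1))]
      exact (sq_le_one_iff₀ (hF.nonneg _ _)).1 this
    rw [hsum, hF.smul _ _ (by positivity)]
    exact mul_le_of_le_one_right (by positivity) hF1

theorem convexOn (x : Plane) : ConvexOn ℝ univ (F x) := by
  refine ⟨convex_univ, fun v _ w _ a b ha hb _ => ?_⟩
  refine (hF.add_le _ _ _).trans ?_
  rw [hF.smul _ _ ha, hF.smul _ _ hb, smul_eq_mul, smul_eq_mul]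

theorem exists_uniform_convexity : ∃ κ : ℝ, 0 < κ ∧ ∀ x v w : Plane,
    κ * ‖v - w‖ ^ 2 ≤ (F x v ^ 2 + F x w ^ 2) / 2 - F x ((1 / 2 : ℝ) • (v + w)) ^ 2 := by
  obtain ⟨K, hK1, hK⟩ := hF.finsler.strongly_convex
  have hK0 : 0 < K := by linarith
  have hc := hF.pos
  -- The first constant comes from segments missing the origin, the second from opposite vectors.
  refine ⟨min (1 / (4 * K ^ 2)) (1 / (16 * c ^ 2)), by positivity, fun x v w => ?_⟩
  have hmain : ∀ v w : Plane, (∃ l : ℝ, 0 ≤ l ∧ v = -l • w) → 1 / (16 * c ^ 2) * ‖v - w‖ ^ 2 ≤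
      (F x v ^ 2 + F x w ^ 2) / 2 - F x ((1 / 2 : ℝ) • (v + w)) ^ 2 := by
    rintro v w ⟨l, hl, hv⟩
    have h1 := hF.add_le_of_neg (x := x) hl hv
    rw [hF.smul _ _ (by norm_num)]
    have h2 : F x (v + w) ^ 2 ≤ F x v ^ 2 + F x w ^ 2 := by
      rcases le_max_iff.1 h1 with h | h
      · nlinarith [hF.nonneg x (v + w), sq_nonneg (F x w)]
      · nlinarith [hF.nonneg x (v + w), sq_nonneg (F x v)]
    have h3 : ‖v - w‖ ≤ c * F x v + c * F x w :=
      (norm_sub_le _ _).trans (add_le_add (hF.lower _ _) (hF.lower _ _))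
    have h4 : ‖v - w‖ ^ 2 ≤ c ^ 2 * (2 * (F x v ^ 2 + F x w ^ 2)) := by
      calc ‖v - w‖ ^ 2 ≤ (c * F x v + c * F x w) ^ 2 := by gcongr
        _ ≤ _ := by nlinarith [sq_nonneg (c * (F x v - F x w))]
    have h5 : 1 / (16 * c ^ 2) * ‖v - w‖ ^ 2 ≤ (F x v ^ 2 + F x w ^ 2) / 8 := by
      rw [div_mul_eq_mul_div, one_mul, div_le_iff₀ (by positivity)]
      linarith
    nlinarith [sq_nonneg (F x v), sq_nonneg (F x w)]
  have hcase : (∃ l : ℝ, 0 ≤ l ∧ v = -l • w) ∨ (∃ l : ℝ, 0 ≤ l ∧ w = -l • v) ∨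
      ∀ t ∈ Icc (0 : ℝ) 1, v + t • (w - v) ≠ 0 := by
    by_cases hw : w = 0
    · exact .inr (.inl ⟨0, le_rfl, by simp [hw]⟩)
    · rcases segment_cases (v := v) hw with h | h
      · exact .inl h
      · exact .inr (.inr h)
  rcases hcase with h | h | h
  · refine le_trans ?_ (hmain v w h)
    gcongr
    exact min_le_right _ _
  · have := hmain w v h
    rw [norm_sub_rev, add_comm w v, add_comm (F x w ^ 2)] at this
    refine le_trans ?_ this
    gcongr
    exact min_le_right _ _
  · have hconv := hF.convexOn_segment (fun x v w hv => (hK x v w hv).1) h (x := x)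
    have := hconv.2 (left_mem_Icc.2 zero_le_one) (right_mem_Icc.2 zero_le_one)
      (by norm_num : (0 : ℝ) ≤ 1 / 2) (by norm_num : (0 : ℝ) ≤ 1 / 2) (by norm_num)
    simp only [smul_eq_mul, mul_zero, mul_one, zero_add, zero_smul, add_zero, one_smul,
      add_sub_cancel] at this
    have h1 : v + (1 / 2 : ℝ) • (w - v) = (1 / 2 : ℝ) • (v + w) := by module
    rw [h1, norm_sub_rev] at this
    have h2 : min (1 / (4 * K ^ 2)) (1 / (16 * c ^ 2)) * ‖v - w‖ ^ 2 ≤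
        1 / 4 * (1 / K ^ 2 * ‖v - w‖ ^ 2) := by
      calc _ ≤ 1 / (4 * K ^ 2) * ‖v - w‖ ^ 2 := by gcongr; exact min_le_left _ _
        _ = _ := by field_simp
    nlinarith

end IsPinched

/-! ### Comparison of the distance with the frozen norms -/

namespace IsPinched

variable {F : Plane → Plane → ℝ} {c : ℝ} (hF : IsPinched F c)

include hF

/-- The derivative of `F` is bounded on the compact set of unit vectors over a ball; homogeneity
extends the estimate to all `v`. -/
theorem exists_lipschitz (R : ℝ) : ∃ L : ℝ, 0 ≤ L ∧ ∀ x y v : Plane, ‖x‖ ≤ R → ‖y‖ ≤ R →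
    |F x v - F y v| ≤ L * ‖x - y‖ * ‖v‖ := by
  set f : Plane × Plane → ℝ := fun p => F p.1 p.2 with hf
  set U : Set (Plane × Plane) := {p | p.2 ≠ 0} with hU
  have hUo : IsOpen U := isOpen_ne_fun continuous_snd continuous_const
  have hd : ContinuousOn (fderiv ℝ f) U :=
    hF.finsler.smooth.continuousOn_fderiv_of_isOpen hUo (by simp)
  have hcomp : IsCompact (Metric.closedBall (0 : Plane) R ×ˢ Metric.sphere (0 : Plane) 1) :=
    (isCompact_closedBall _ _).prod (isCompact_sphere _ _)
  have hsub : Metric.closedBall (0 : Plane) R ×ˢ Metric.sphere (0 : Plane) 1 ⊆ U := by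
    rintro ⟨x, v⟩ ⟨-, hv⟩
    exact ne_zero_of_mem_unit_sphere (⟨v, hv⟩ : Metric.sphere (0 : Plane) 1)
  obtain ⟨L, hL⟩ := hcomp.exists_bound_of_continuousOn (hd.mono hsub)
  refine ⟨max L 0, le_max_right _ _, fun x y v hx hy => ?_⟩
  by_cases hv : v = 0
  · simp [hv, hF.zero]
  have hv0 : 0 < ‖v‖ := norm_pos_iff.2 hv
  set u : Plane := ‖v‖⁻¹ • v with hu
  have hun : ‖u‖ = 1 := by rw [hu, norm_smul, norm_inv, norm_norm, inv_mul_cancel₀ hv0.ne']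
  have hvu : v = ‖v‖ • u := by rw [hu, smul_inv_smul₀ hv0.ne']
  have hlip : ‖f (x, u) - f (y, u)‖ ≤ max L 0 * ‖((x, u) : Plane × Plane) - (y, u)‖ := by
    refine Convex.norm_image_sub_le_of_norm_hasFDerivWithin_le (𝕜 := ℝ) (f' := fderiv ℝ f)
      (s := Metric.closedBall (0 : Plane) R ×ˢ {u}) ?_ ?_
      ((convex_closedBall _ _).prod (convex_singleton _)) ?_ ?_
    · rintro ⟨z, w⟩ ⟨hz, hw⟩
      rw [show w = u from mem_singleton_iff.1 hw]
      have hmem : ((z, u) : Plane × Plane) ∈ U := hsub ⟨hz, by simpa using hun⟩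
      exact ((hF.finsler.smooth.contDiffAt (hUo.mem_nhds hmem)).differentiableAt
        (by simp)).hasFDerivAt.hasFDerivWithinAt
    · rintro ⟨z, w⟩ ⟨hz, hw⟩
      rw [show w = u from mem_singleton_iff.1 hw]
      exact (hL (z, u) ⟨hz, by simpa using hun⟩).trans (le_max_left _ _)
    · exact ⟨by simpa using hy, rfl⟩
    · exact ⟨by simpa using hx, rfl⟩
  have hn : ‖((x, u) : Plane × Plane) - (y, u)‖ = ‖x - y‖ := by
    simp [Prod.norm_def]
  rw [hn] at hlip
  rw [hvu, hF.smul _ _ hv0.le, hF.smul _ _ hv0.le, ← mul_sub, abs_mul, abs_norm, ← hvu, mul_comm]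
  exact mul_le_mul_of_nonneg_right hlip hv0.le

/-- Jensen's inequality: straight segments are shortest for the constant norm `F x`. -/
theorem le_integral_of_curve (x : Plane) {γ : ℝ → Plane} (h : IsPiecewiseC1 γ 0 1) :
    F x (γ 1 - γ 0) ≤ ∫ t in (0 : ℝ)..1, F x (deriv γ t) := by
  have : IsProbabilityMeasure (volume.restrict (Ioc (0 : ℝ) 1)) := ⟨by simp⟩
  rw [← h.integral_deriv, intervalIntegral.integral_of_le zero_le_one,
    intervalIntegral.integral_of_le zero_le_one]
  refine (hF.convexOn x).map_integral_le (hF.continuous_right x).continuousOn isClosed_univ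
    (by simp) ?_ ?_
  · exact (intervalIntegrable_iff_integrableOn_Ioc_of_le zero_le_one).1 h.intervalIntegrable_deriv
  · exact (intervalIntegrable_iff_integrableOn_Ioc_of_le zero_le_one).1
      (h.intervalIntegrable_comp_deriv (Φ := fun p => F x p.2)
        ((hF.continuous_right x).comp continuous_snd))

/-- Almost shortest curves from `p` to `y` have length `O(‖y - p‖)` and stay that close to `p`, so
freezing the base point costs `O(‖y - p‖)` per unit length. -/
theorem exists_abs_sub_dist_le (R : ℝ) : ∃ C : ℝ, 0 ≤ C ∧ ∀ p y : Plane, ‖p‖ ≤ R → ‖y‖ ≤ R →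
    |F p (y - p) - dist F p y| ≤ C * ‖y - p‖ ^ 2 := by
  have hc := hF.one_le
  obtain ⟨L, hL0, hL⟩ := hF.exists_lipschitz (R + c * (c + 1) * (2 * R))
  refine ⟨L * (c * (c + 1)) ^ 2, by positivity, fun p y hp hy => ?_⟩
  have hR : 0 ≤ R := (norm_nonneg p).trans hp
  set δ := ‖y - p‖ with hδ
  have hδR : δ ≤ 2 * R := (norm_sub_le _ _).trans (by linarith)
  have hcc : 1 ≤ c * (c + 1) := by nlinarith
  rw [abs_le]
  constructor
  · have h1 : dist F p y ≤ F p (y - p) + L * δ ^ 2 := by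
      refine (hF.dist_le_segment p y).trans ?_
      calc _ ≤ ∫ _t in (0 : ℝ)..1, (F p (y - p) + L * δ ^ 2) := by
            refine intervalIntegral.integral_mono_on zero_le_one
              (hF.intervalIntegrable_segment _ _ _) (by simp) fun t ht => ?_
            have h2 : ‖p + t • (y - p)‖ ≤ R + c * (c + 1) * (2 * R) := by
              refine (norm_add_le _ _).trans ?_
              rw [norm_smul, Real.norm_of_nonneg ht.1]
              nlinarith [ht.2, norm_nonneg (y - p), mul_le_mul_of_nonneg_right hcc (by linarith : 0 ≤ 2 * R)]
            have h3 := (abs_le.1 (hL (p + t • (y - p)) p (y - p) h2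
              (by nlinarith [mul_le_mul_of_nonneg_right hcc (by linarith : 0 ≤ 2 * R)]))).2
            rw [add_sub_cancel_left, norm_smul, Real.norm_of_nonneg ht.1, ← hδ] at h3
            have h4 : L * (t * δ) * δ ≤ L * δ ^ 2 := by
              have : t * δ ≤ 1 * δ := mul_le_mul_of_nonneg_right ht.2 (norm_nonneg _)
              calc L * (t * δ) * δ ≤ L * (1 * δ) * δ := by gcongr
                _ = _ := by ring
            linarith
        _ = _ := by simp
    have h2 : L * δ ^ 2 ≤ L * (c * (c + 1)) ^ 2 * δ ^ 2 := by
      have : (1 : ℝ) ≤ (c * (c + 1)) ^ 2 := one_le_pow₀ hcc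
      nlinarith [mul_nonneg hL0 (sq_nonneg δ)]
    linarith
  · rcases (norm_nonneg (y - p)).eq_or_lt with h0 | hpos
    · have hy0 : y - p = 0 := norm_eq_zero.1 h0.symm
      rw [hy0, hF.zero]
      have := hF.dist_nonneg p y
      have : 0 ≤ L * (c * (c + 1)) ^ 2 * δ ^ 2 := by positivity
      linarith
    · suffices h : F p (y - p) ≤ dist F p y + L * (c * (c + 1)) ^ 2 * δ ^ 2 by linarith
      refine le_of_forall_pos_le_add fun η hη => ?_
      -- The slack `η` is sent to zero; the slack `‖y - p‖` keeps the length below `(c + 1) * ‖y -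
      -- p‖`.
      obtain ⟨γ, h, h0, h1, hl⟩ := exists_curve F p y (lt_min hη hpos)
      have hl1 : length F γ 0 1 ≤ (c + 1) * δ := by
        have := hF.dist_le_norm p y
        have := min_le_right η ‖y - p‖
        linarith
      have hl2 : c * length F γ 0 1 ≤ c * (c + 1) * δ := by
        rw [mul_assoc]
        exact mul_le_mul_of_nonneg_left hl1 hF.pos.le
      have hclose : ∀ t ∈ Icc (0 : ℝ) 1, ‖γ t - p‖ ≤ c * (c + 1) * δ := by
        intro t ht
        have h2 := hF.norm_sub_le_length (h.mono le_rfl ht.1 ht.2)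
        have h3 := hF.length_add h ht.1 ht.2
        have h4 := hF.length_nonneg (γ := γ) ht.2
        rw [h0] at h2
        refine h2.trans (le_trans ?_ hl2)
        exact mul_le_mul_of_nonneg_left (by linarith) hF.pos.le
      have hint := hF.le_integral_of_curve p h
      rw [h0, h1] at hint
      have hn := hF.integral_norm_deriv_le h
      have hpt : ∀ t ∈ Icc (0 : ℝ) 1, F p (deriv γ t) ≤
          F (γ t) (deriv γ t) + L * (c * (c + 1) * δ) * ‖deriv γ t‖ := by
        intro t ht
        have h2 := hclose t ht
        have h3 : c * (c + 1) * δ ≤ c * (c + 1) * (2 * R) := by gcongr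
        have h4 : ‖γ t‖ ≤ R + c * (c + 1) * (2 * R) := by
          have := norm_le_norm_add_norm_sub' (γ t) p
          linarith
        have h5 := (abs_le.1 (hL p (γ t) (deriv γ t) (by nlinarith) h4)).2
        have h6 : L * ‖p - γ t‖ * ‖deriv γ t‖ ≤ L * (c * (c + 1) * δ) * ‖deriv γ t‖ := by
          rw [norm_sub_rev]
          gcongr
        linarith
      have hmono := intervalIntegral.integral_mono_on zero_le_one
        (h.intervalIntegrable_comp_deriv (Φ := fun q => F p q.2)
          ((hF.continuous_right p).comp continuous_snd))
        ((hF.intervalIntegrable_length h).add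
          (h.intervalIntegrable_deriv.norm.const_mul (L * (c * (c + 1) * δ)))) hpt
      rw [intervalIntegral.integral_add (hF.intervalIntegrable_length h)
        (h.intervalIntegrable_deriv.norm.const_mul _), intervalIntegral.integral_const_mul] at hmono
      have h7 : L * (c * (c + 1) * δ) * ∫ t in (0 : ℝ)..1, ‖deriv γ t‖ ≤
          L * (c * (c + 1) * δ) * (c * (c + 1) * δ) := by
        have : 0 ≤ L * (c * (c + 1) * δ) := by positivity
        exact mul_le_mul_of_nonneg_left (hn.trans hl2) this
      have h8 := min_le_left η ‖y - p‖
      unfold length at hl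
      nlinarith

end IsPinched

/-! ### Regularity of distance-realising curves -/

/-- The forward difference quotient of `σ` at `t` with step `2⁻ᵏ`. -/
noncomputable def dyadicQuotient (σ : ℝ → Plane) (k : ℕ) (t : ℝ) : Plane :=
  (2 : ℝ) ^ k • (σ (t + ((2 : ℝ) ^ k)⁻¹) - σ t)

theorem tendsto_inv_two_pow : Tendsto (fun k : ℕ => ((2 : ℝ) ^ k)⁻¹) atTop (𝓝 0) := by
  exact tendsto_inv_atTop_zero.comp (tendsto_pow_atTop_atTop_of_one_lt (one_lt_two (α := ℝ)))

/-- If the dyadic difference quotients of a continuous curve converge uniformly on an open set,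
their limit is the derivative. -/
theorem hasDerivAt_of_tendstoUniformlyOn_dyadicQuotient {σ V : ℝ → Plane} (hσ : Continuous σ)
    {S : Set ℝ} (hS : IsOpen S) (h : TendstoUniformlyOn (dyadicQuotient σ) V atTop S) {t : ℝ}
    (ht : t ∈ S) : HasDerivAt σ (V t) t := by
  -- The quotients of the primitive `Φ` converge to `σ` and have the quotients of `σ` as
  -- derivatives, so the limit may be differentiated.
  set Φ : ℝ → Plane := fun t => ∫ s in (0 : ℝ)..t, σ s
  have hΦ : ∀ t, HasDerivAt Φ (σ t) t := fun t => hσ.integral_hasStrictDerivAt 0 t |>.hasDerivAt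
  refine hasDerivAt_of_tendstoLocallyUniformlyOn (f := dyadicQuotient Φ) hS
    h.tendstoLocallyUniformlyOn (Eventually.of_forall fun k x _ => ?_) (fun x _ => ?_) ht
  · exact (((hΦ (x + ((2 : ℝ) ^ k)⁻¹)).comp_add_const x _).sub (hΦ x)).const_smul ((2 : ℝ) ^ k)
  · have h1 : Tendsto (fun k : ℕ => ((2 : ℝ) ^ k)⁻¹) atTop (𝓝[≠] 0) :=
      tendsto_nhdsWithin_iff.2 ⟨tendsto_inv_two_pow, Eventually.of_forall fun k => by simp⟩
    have h2 := (hΦ x).tendsto_slope_zero.comp h1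
    refine h2.congr fun k => ?_
    simp [dyadicQuotient]

namespace IsPinched

variable {F : Plane → Plane → ℝ} {c : ℝ} (hF : IsPinched F c) {σ : ℝ → Plane}
  (hσ : ∀ s t, s ≤ t → dist F (σ s) (σ t) = t - s)

include hF

/-- Two consecutive steps of `F`-length `h` of a distance-realising curve have almost the same
direction, because `F ^ 2` is uniformly convex. -/
theorem norm_sq_quotient_sub_le {L C κ R h : ℝ} {p q r : Plane} (hL0 : 0 ≤ L) (hC0 : 0 ≤ C)
    (hL : ∀ x y v : Plane, ‖x‖ ≤ R → ‖y‖ ≤ R → |F x v - F y v| ≤ L * ‖x - y‖ * ‖v‖)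
    (hC : ∀ p y : Plane, ‖p‖ ≤ R → ‖y‖ ≤ R → |F p (y - p) - dist F p y| ≤ C * ‖y - p‖ ^ 2)
    (hκ : ∀ x v w : Plane, κ * ‖v - w‖ ^ 2 ≤
      (F x v ^ 2 + F x w ^ 2) / 2 - F x ((1 / 2 : ℝ) • (v + w)) ^ 2)
    (hp : ‖p‖ ≤ R) (hq : ‖q‖ ≤ R) (hr : ‖r‖ ≤ R) (hh : 0 < h) (hh1 : h ≤ 1)
    (dpq : dist F p q = h) (dqr : dist F q r = h) (dpr : dist F p r = 2 * h) :
    κ * ‖h⁻¹ • (q - p) - h⁻¹ • (r - q)‖ ^ 2 ≤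
      (4 * ((2 * C + L) * c ^ 2) + ((2 * C + L) * c ^ 2) ^ 2) * h := by
  have hc := hF.pos
  -- `E * h` is the relative error when all steps are measured at `p`: both unit steps have norm at
  -- most `1 + E * h`, their mean at least `1 - E * h`.
  obtain ⟨E, hE⟩ : ∃ E, E = (2 * C + L) * c ^ 2 := ⟨_, rfl⟩
  have hE0 : 0 ≤ E := by rw [hE]; positivity
  rw [← hE]
  have npq := hF.norm_sub_le_dist p q
  have nqr := hF.norm_sub_le_dist q r
  have npr := hF.norm_sub_le_dist p r
  have cpq := (abs_le.1 (hC p q hp hq)).2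
  have cqr := (abs_le.1 (hC q r hq hr)).2
  have cpr := (abs_le.1 (hC p r hp hr)).1
  have lqr := (abs_le.1 (hL p q (r - q) hp hq)).2
  rw [dpq] at npq cpq
  rw [dqr] at nqr cqr
  rw [dpr] at npr cpr
  have spq : C * ‖q - p‖ ^ 2 ≤ C * (c * h) ^ 2 := by gcongr
  have sqr : C * ‖r - q‖ ^ 2 ≤ C * (c * h) ^ 2 := by gcongr
  have spr : C * ‖r - p‖ ^ 2 ≤ C * (c * (2 * h)) ^ 2 := by gcongr
  have slqr : L * ‖p - q‖ * ‖r - q‖ ≤ L * (c * h) * (c * h) := by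
    rw [norm_sub_rev]
    gcongr
  have hinv : 0 ≤ h⁻¹ := (inv_pos.2 hh).le
  have hEh : h * (E * h) = 2 * (C * (c * h) ^ 2) + L * (c * h) * (c * h) := by rw [hE]; ring
  have hEh' : (1 - E * h) * (2 * h) =
      2 * h - C * (c * (2 * h)) ^ 2 - 2 * (L * (c * h) ^ 2) := by rw [hE]; ring
  have hCn : 0 ≤ C * (c * h) ^ 2 := by positivity
  have hLn : 0 ≤ L * (c * h) ^ 2 := by positivity
  have hLn' : 0 ≤ L * (c * h) * (c * h) := by positivity
  have hX : F p (h⁻¹ • (q - p)) ≤ 1 + E * h := by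
    rw [hF.smul _ _ hinv, inv_mul_le_iff₀ hh, mul_add, hEh]
    linarith
  have hY : F p (h⁻¹ • (r - q)) ≤ 1 + E * h := by
    rw [hF.smul _ _ hinv, inv_mul_le_iff₀ hh, mul_add, hEh]
    linarith
  have hmid : (1 / 2 : ℝ) • (h⁻¹ • (q - p) + h⁻¹ • (r - q)) = (2 * h)⁻¹ • (r - p) := by
    rw [← smul_add, smul_smul, sub_add_sub_cancel', mul_inv, one_div]
  have hZ : 1 - E * h ≤ F p ((2 * h)⁻¹ • (r - p)) := by
    rw [hF.smul _ _ (by positivity), ← div_eq_inv_mul, le_div_iff₀ (by positivity), hEh']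
    linarith
  have hfin := hκ p (h⁻¹ • (q - p)) (h⁻¹ • (r - q))
  rw [hmid] at hfin
  have hX2 := pow_le_pow_left₀ (hF.nonneg _ _) hX 2
  have hY2 := pow_le_pow_left₀ (hF.nonneg _ _) hY 2
  have hZ2 : 1 - 2 * (E * h) ≤ F p ((2 * h)⁻¹ • (r - p)) ^ 2 := by
    -- Using `x ^ 2 ≥ 2 * x - 1` avoids needing `E * h ≤ 1`.
    have := sq_nonneg (F p ((2 * h)⁻¹ • (r - p)) - 1)
    linarith
  have hh3 : E ^ 2 * h ^ 2 ≤ E ^ 2 * h :=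
    mul_le_mul_of_nonneg_left (pow_le_of_le_one hh.le hh1 two_ne_zero) (sq_nonneg E)
  linarith

include hσ

theorem norm_sub_le_of_isometry {s t : ℝ} (h : s ≤ t) : ‖σ t - σ s‖ ≤ c * (t - s) := by
  rw [← hσ s t h]
  exact hF.norm_sub_le_dist _ _

theorem continuous_of_isometry : Continuous σ := by
  have : LipschitzWith c.toNNReal σ := by
    refine LipschitzWith.of_dist_le_mul fun s t => ?_
    rw [dist_eq_norm, Real.dist_eq, Real.coe_toNNReal c hF.pos.le]
    rcases le_total s t with h | h
    · rw [norm_sub_rev, abs_sub_comm, abs_of_nonneg (sub_nonneg.2 h)]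
      exact hF.norm_sub_le_of_isometry hσ h
    · rw [abs_of_nonneg (sub_nonneg.2 h)]
      exact hF.norm_sub_le_of_isometry hσ h
  exact this.continuous

theorem norm_le_of_isometry {N t : ℝ} (ht : |t| ≤ N) : ‖σ t‖ ≤ ‖σ 0‖ + c * N := by
  obtain ⟨h1, h2⟩ := abs_le.1 ht
  have hc := hF.pos
  have h3 : ‖σ t - σ 0‖ ≤ c * N := by
    rcases le_total 0 t with h | h
    · refine (hF.norm_sub_le_of_isometry hσ h).trans ?_
      gcongr
      linarith
    · rw [norm_sub_rev]
      refine (hF.norm_sub_le_of_isometry hσ h).trans ?_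
      gcongr
      linarith
  have := norm_le_norm_add_norm_sub' (σ t) (σ 0)
  linarith

theorem exists_norm_sq_quotient_sub_le (N : ℝ) : ∃ A : ℝ, 0 ≤ A ∧ ∀ s h : ℝ, |s| ≤ N → 0 < h →
    h ≤ 1 / 2 →
    ‖h⁻¹ • (σ (s + h) - σ s) - h⁻¹ • (σ (s + 2 * h) - σ (s + h))‖ ^ 2 ≤ A * h := by
  have hc := hF.pos
  obtain ⟨L, hL0, hL⟩ := hF.exists_lipschitz (‖σ 0‖ + c * (N + 1))
  obtain ⟨C, hC0, hC⟩ := hF.exists_abs_sub_dist_le (‖σ 0‖ + c * (N + 1))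
  obtain ⟨κ, hκ, hconv⟩ := hF.exists_uniform_convexity
  refine ⟨(4 * ((2 * C + L) * c ^ 2) + ((2 * C + L) * c ^ 2) ^ 2) / κ, by positivity,
    fun s h hs hh hh2 => ?_⟩
  obtain ⟨hs1, hs2⟩ := abs_le.1 hs
  have hbd : ∀ t, |t| ≤ N + 1 → ‖σ t‖ ≤ ‖σ 0‖ + c * (N + 1) := fun t ht =>
    hF.norm_le_of_isometry hσ ht
  rw [div_mul_eq_mul_div, le_div_iff₀ hκ, mul_comm _ κ]
  refine hF.norm_sq_quotient_sub_le hL0 hC0 hL hC hconv (hbd s (by linarith))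
    (hbd _ (abs_le.2 ⟨by linarith, by linarith⟩)) (hbd _ (abs_le.2 ⟨by linarith, by linarith⟩))
    hh (by linarith) ?_ ?_ ?_
  · rw [hσ _ _ (by linarith)]
    ring
  · rw [hσ _ _ (by linarith)]
    ring
  · rw [hσ _ _ (by linarith)]
    ring

/-- The quotient with step `2 * h` is the mean of two consecutive ones with step `h`, so it differs
from the first by half their difference. -/
theorem exists_norm_dyadicQuotient_sub_le (N : ℝ) : ∃ B : ℝ, 0 ≤ B ∧ ∀ (k : ℕ) (t : ℝ), |t| ≤ N →
    ‖dyadicQuotient σ k t - dyadicQuotient σ (k + 1) t‖ ≤ B * √(1 / 2) ^ k := by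
  obtain ⟨A, hA0, hA⟩ := hF.exists_norm_sq_quotient_sub_le hσ N
  refine ⟨√A, Real.sqrt_nonneg _, fun k t ht => ?_⟩
  set h : ℝ := ((2 : ℝ) ^ (k + 1))⁻¹ with hh
  have hpow : (2 : ℝ) ^ (k + 1) = 2 * 2 ^ k := pow_succ' _ _
  have h0 : 0 < h := by positivity
  have h2 : h ≤ 1 / 2 := by
    rw [hh, hpow, one_div]
    gcongr
    linarith [one_le_pow₀ (one_le_two (α := ℝ)) (n := k)]
  have hhk : ((2 : ℝ) ^ k)⁻¹ = 2 * h := by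
    rw [hh, hpow, mul_inv]
    ring
  have hmain := hA t h ht h0 h2
  have heq : dyadicQuotient σ k t - dyadicQuotient σ (k + 1) t =
      -(1 / 2 : ℝ) • (h⁻¹ • (σ (t + h) - σ t) - h⁻¹ • (σ (t + 2 * h) - σ (t + h))) := by
    have e1 : (2 : ℝ) ^ (k + 1) = h⁻¹ := by rw [hh, inv_inv]
    have e2 : (2 : ℝ) ^ k = (1 / 2) * h⁻¹ := by rw [← e1, hpow]; ring
    unfold dyadicQuotient
    rw [hhk, ← hh, e1, e2]
    module
  have hsq : A * h ≤ (√A * √(1 / 2) ^ k) ^ 2 := by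
    rw [mul_pow, Real.sq_sqrt hA0, ← pow_mul, mul_comm k 2, pow_mul, Real.sq_sqrt (by norm_num)]
    refine mul_le_mul_of_nonneg_left ?_ hA0
    rw [hh, hpow, one_div, inv_pow]
    gcongr
    linarith [pow_pos (two_pos (α := ℝ)) k]
  have hle := (sq_le_sq₀ (norm_nonneg _) (by positivity)).1 (hmain.trans hsq)
  rw [heq, norm_smul, norm_neg, Real.norm_of_nonneg (by norm_num)]
  linarith [norm_nonneg (h⁻¹ • (σ (t + h) - σ t) - h⁻¹ • (σ (t + 2 * h) - σ (t + h)))]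

theorem exists_tendstoUniformlyOn_dyadicQuotient : ∃ V : ℝ → Plane, ∀ N : ℝ,
    TendstoUniformlyOn (dyadicQuotient σ) V atTop (Ioo (-N) N) := by
  have hr1 : √(1 / 2) < 1 := by
    rw [Real.sqrt_lt' one_pos]
    norm_num
  have hex : ∀ t, ∃ v, Tendsto (fun k => dyadicQuotient σ k t) atTop (𝓝 v) := by
    intro t
    obtain ⟨B, -, hB⟩ := hF.exists_norm_dyadicQuotient_sub_le hσ |t|
    refine cauchySeq_tendsto_of_complete (cauchySeq_of_le_geometric _ B hr1 fun k => ?_)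
    rw [dist_eq_norm]
    exact hB k t le_rfl
  choose V hV using hex
  refine ⟨V, fun N => ?_⟩
  obtain ⟨B, -, hB⟩ := hF.exists_norm_dyadicQuotient_sub_le hσ N
  rw [Metric.tendstoUniformlyOn_iff]
  intro ε hε
  have h0 : Tendsto (fun k : ℕ => B * √(1 / 2) ^ k / (1 - √(1 / 2))) atTop (𝓝 0) := by
    simpa using ((tendsto_pow_atTop_nhds_zero_of_lt_one (Real.sqrt_nonneg _) hr1).const_mul
      B).div_const (1 - √(1 / 2))
  filter_upwards [h0.eventually_lt_const hε] with k hk t ht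
  rw [_root_.dist_comm]
  refine (dist_le_of_le_geometric_of_tendsto _ B hr1 (fun n => ?_) (hV t) k).trans_lt hk
  rw [dist_eq_norm]
  exact hB n t (abs_le.2 ⟨ht.1.le, ht.2.le⟩)

/-- A curve that is parametrised by `F`-arc length and realises distances is `C¹`. -/
theorem isMinimalGeodesic_of_isometry : IsMinimalGeodesic F σ := by
  have hcont := hF.continuous_of_isometry hσ
  obtain ⟨V, hV⟩ := hF.exists_tendstoUniformlyOn_dyadicQuotient hσ
  have hmem : ∀ t : ℝ, t ∈ Ioo (-(|t| + 1)) (|t| + 1) := fun t =>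
    ⟨by linarith [neg_abs_le t], by linarith [le_abs_self t]⟩
  have hderiv : ∀ t, HasDerivAt σ (V t) t := fun t =>
    hasDerivAt_of_tendstoUniformlyOn_dyadicQuotient hcont isOpen_Ioo (hV _) (hmem t)
  have hdσ : deriv σ = V := funext fun t => (hderiv t).deriv
  have hVc : Continuous V := by
    rw [continuous_iff_continuousAt]
    intro t
    refine ContinuousOn.continuousAt ((hV (|t| + 1)).continuousOn (Frequently.of_forall fun k => ?_))
      (isOpen_Ioo.mem_nhds (hmem t))
    unfold dyadicQuotient
    fun_prop
  refine ⟨contDiff_one_iff_deriv.2 ⟨fun t => (hderiv t).differentiableAt, hdσ ▸ hVc⟩,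
    fun t => ?_, hσ⟩
  rw [hdσ]
  obtain ⟨C, hC0, hC⟩ := hF.exists_abs_sub_dist_le (‖σ 0‖ + c * (|t| + 1))
  have hlim : Tendsto (fun k => F (σ t) (dyadicQuotient σ k t)) atTop (𝓝 (F (σ t) (V t))) :=
    ((hF.continuous_right (σ t)).tendsto _).comp ((hV (|t| + 1)).tendsto_at (hmem t))
  -- The distance covered in time `2⁻ᵏ` is exactly `2⁻ᵏ`, and the frozen norm differs from it by
  -- `O(4⁻ᵏ)`.
  have hlim1 : Tendsto (fun k => F (σ t) (dyadicQuotient σ k t)) atTop (𝓝 1) := by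
    refine tendsto_iff_norm_sub_tendsto_zero.2 (squeeze_zero (g := fun k : ℕ =>
      C * c ^ 2 * ((2 : ℝ) ^ k)⁻¹) (fun k => norm_nonneg _) (fun k => ?_) ?_)
    · have hk : (0 : ℝ) < 2 ^ k := by positivity
      have hk1 : ((2 : ℝ) ^ k)⁻¹ ≤ 1 := inv_le_one_of_one_le₀ (one_le_pow₀ one_le_two)
      have hk0 : (0 : ℝ) < ((2 : ℝ) ^ k)⁻¹ := by positivity
      have hle : t ≤ t + ((2 : ℝ) ^ k)⁻¹ := by linarith
      have h1 := hC (σ t) (σ (t + ((2 : ℝ) ^ k)⁻¹)) (hF.norm_le_of_isometry hσ (by linarith))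
        (hF.norm_le_of_isometry hσ ((abs_add_le _ _).trans (by rw [abs_of_pos hk0]; linarith)))
      have h2 := hF.norm_sub_le_of_isometry hσ hle
      rw [hσ _ _ hle] at h1
      rw [add_sub_cancel_left] at h1 h2
      have hFk : F (σ t) (dyadicQuotient σ k t) - 1 = 2 ^ k *
          (F (σ t) (σ (t + ((2 : ℝ) ^ k)⁻¹) - σ t) - ((2 : ℝ) ^ k)⁻¹) := by
        rw [dyadicQuotient, hF.smul _ _ hk.le, mul_sub, mul_inv_cancel₀ hk.ne']
      rw [hFk, Real.norm_eq_abs, abs_mul, abs_of_pos hk]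
      calc _ ≤ 2 ^ k * (C * (c * ((2 : ℝ) ^ k)⁻¹) ^ 2) := by
            gcongr
            exact h1.trans (by gcongr)
        _ = _ := by field_simp
    · simpa using tendsto_inv_two_pow.const_mul (C * c ^ 2)
  exact tendsto_nhds_unique hlim hlim1

end IsPinched

/-! ### Weighted minimisation and horizontal drift -/

theorem abs_apply_le_norm (x : Plane) (i : Fin 2) : |x i| ≤ ‖x‖ :=
  PiLp.norm_apply_le x i

theorem norm_le_abs_add_abs (x : Plane) : ‖x‖ ≤ |x 0| + |x 1| := by
  rw [EuclideanSpace.norm_eq, Fin.sum_univ_two]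
  refine Real.sqrt_le_iff.2 ⟨by positivity, ?_⟩
  rw [Real.norm_eq_abs, Real.norm_eq_abs]
  nlinarith [mul_nonneg (abs_nonneg (x 0)) (abs_nonneg (x 1))]

@[simp]
theorem e₁_apply_zero : e₁ 0 = 1 := by simp [e₁]

@[simp]
theorem e₁_apply_one : e₁ 1 = 0 := by simp [e₁]

theorem norm_smul_e₁ (a : ℝ) : ‖a • e₁‖ = |a| := by
  rw [EuclideanSpace.norm_eq, Fin.sum_univ_two]
  simp [Real.sqrt_sq_eq_abs]

namespace IsPinched

variable {F : Plane → Plane → ℝ} {c : ℝ} (hF : IsPinched F c)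
  (hper : ∀ (k : ℤ) (x v : Plane), F (x + (k : ℝ) • e₁) v = F x v)

include hF hper

theorem dist_add_smul_e₁ (k : ℤ) (x y : Plane) :
    dist F (x + (k : ℝ) • e₁) (y + (k : ℝ) • e₁) = dist F x y := by
  refine le_antisymm (hF.dist_translate_le (hper k) x y) ?_
  have := hF.dist_translate_le (hper (-k)) (x + (k : ℝ) • e₁) (y + (k : ℝ) • e₁)
  simpa [add_assoc, ← add_smul] using this

variable {α : ℝ} (hα0 : 0 ≤ α) (hα : c * α ≤ 1)

include hα0 hα

omit hper in
theorem bddBelow_range_dist_sub (A B : Plane) :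
    BddBelow (range fun k : ℤ => dist F A (B + (k : ℝ) • e₁) - α * k) := by
  refine ⟨-(‖B - A‖ / c), ?_⟩
  rintro _ ⟨k, rfl⟩
  have hc := hF.pos
  have h1 := hF.norm_sub_le_dist A (B + (k : ℝ) • e₁)
  have h2 : ‖(k : ℝ) • e₁‖ ≤ ‖B + (k : ℝ) • e₁ - A‖ + ‖B - A‖ := by
    have : (k : ℝ) • e₁ = (B + (k : ℝ) • e₁ - A) - (B - A) := by abel
    rw [this]
    refine (norm_sub_le _ _).trans (le_of_eq ?_)
    rw [← this]
  rw [norm_smul_e₁] at h2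
  have h3 : c * (α * k) ≤ |(k : ℝ)| := by
    have h4 : c * α * k ≤ c * α * |(k : ℝ)| :=
      mul_le_mul_of_nonneg_left (le_abs_self _) (by positivity)
    have h5 : c * α * |(k : ℝ)| ≤ 1 * |(k : ℝ)| := mul_le_mul_of_nonneg_right hα (abs_nonneg _)
    linarith
  dsimp only
  rw [neg_le_iff_add_nonneg', ← sub_nonneg, sub_zero]
  have h6 : 0 ≤ c * (‖B - A‖ / c + (dist F A (B + (k : ℝ) • e₁) - α * k)) := by
    rw [mul_add, mul_div_cancel₀ _ hc.ne', mul_sub]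
    linarith
  exact nonneg_of_mul_nonneg_right h6 hc

/-- A curve that almost minimises `length - α * k` among all curves from `A` to some
`B + k • e₁` inherits this property on all its segments. -/
theorem exists_almost_minimal_curve (A B : Plane) {δ : ℝ} (hδ : 0 < δ) :
    ∃ γ : ℝ → Plane, IsPiecewiseC1 γ 0 1 ∧ γ 0 = A ∧ (γ 1) 1 = B 1 ∧
      ∀ s t, 0 ≤ s → s ≤ t → t ≤ 1 → ∀ j : ℤ,
        length F γ s t - δ ≤ dist F (γ s) (γ t + (j : ℝ) • e₁) - α * j := by
  have hbdd := hF.bddBelow_range_dist_sub hα0 hα A B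
  obtain ⟨_, ⟨k, rfl⟩, hk⟩ := exists_lt_of_csInf_lt
    (range_nonempty fun k : ℤ => dist F A (B + (k : ℝ) • e₁) - α * k)
    (lt_add_of_pos_right _ (half_pos hδ))
  obtain ⟨γ, h, h0, h1, hl⟩ := exists_curve F A (B + (k : ℝ) • e₁) (half_pos hδ)
  refine ⟨γ, h, h0, by simp [h1], fun s t hs hst ht j => ?_⟩
  have e1 := hF.length_add h hs (hst.trans ht)
  have e2 := hF.length_add (h.mono hs (hst.trans ht) le_rfl) hst ht
  have e3 := hF.dist_le_length (h.mono le_rfl hs (hst.trans ht))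
  have e4 := hF.dist_le_length (h.mono (hs.trans hst) ht le_rfl)
  -- The competitor follows `γ` to `γ s`, jumps to `γ t + j • e₁` and then follows the translated
  -- tail of `γ`.
  have e5 := csInf_le hbdd ⟨k + j, rfl⟩
  have e6 := hF.dist_triangle A (γ s) (B + ((k + j : ℤ) : ℝ) • e₁)
  have e7 := hF.dist_triangle (γ s) (γ t + (j : ℝ) • e₁) (B + ((k + j : ℤ) : ℝ) • e₁)
  have e8 : B + ((k + j : ℤ) : ℝ) • e₁ = γ 1 + (j : ℝ) • e₁ := by
    rw [h1]
    push_cast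
    module
  have e9 := hF.dist_add_smul_e₁ hper j (γ t) (γ 1)
  rw [← e8] at e9
  rw [h0] at e3
  push_cast at *
  linarith

omit hper hα0 hα in
theorem exists_length_eq {γ : ℝ → Plane} (h : IsPiecewiseC1 γ 0 1) {τ : ℝ} (h0 : 0 ≤ τ)
    (h1 : τ ≤ length F γ 0 1) : ∃ t ∈ Icc (0 : ℝ) 1, length F γ 0 t = τ := by
  have hint := hF.intervalIntegrable_length h
  have hcont : ContinuousOn (fun t => length F γ 0 t) (Icc 0 1) := by
    have := intervalIntegral.continuousOn_primitive_interval' hint left_mem_uIcc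
    rwa [uIcc_of_le zero_le_one] at this
  exact intermediate_value_Icc zero_le_one hcont ⟨by simpa [length] using h0, h1⟩

/-- Long almost minimal arcs, parametrised by `F`-arc length and normalised to start in a fixed
compact set. -/
theorem exists_almost_minimal_arc {n δ : ℝ} (hn : 0 ≤ n) (hδ : 0 < δ) :
    ∃ σ : ℝ → Plane, (∀ τ, c * |τ| ≤ n → ‖σ τ‖ ≤ 1 + c * |τ|) ∧
      ∀ s t, c * |s| ≤ n → c * |t| ≤ n → s ≤ t → dist F (σ s) (σ t) ≤ t - s ∧
        ∀ j : ℤ, t - s - δ ≤ dist F (σ s) (σ t + (j : ℝ) • e₁) - α * j := by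
  have hc := hF.pos
  obtain ⟨γ, h, h0, h1, hmin⟩ :=
    hF.exists_almost_minimal_curve hper hα0 hα !₂[0, -n] !₂[0, n] hδ
  have h0' : (γ 0) 1 = -n := by simp [h0]
  have h1' : (γ 1) 1 = n := by simp [h1]
  have hcont : ContinuousOn (fun t => (γ t) 1) (Icc 0 1) :=
    (EuclideanSpace.proj (𝕜 := ℝ) (1 : Fin 2)).continuous.comp_continuousOn h.1
  -- From a crossing of height 0, at least `n / c` of length remains on either side.
  obtain ⟨t₀, ht₀, hγ₀⟩ : (0 : ℝ) ∈ (fun t => (γ t) 1) '' Icc 0 1 :=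
    intermediate_value_Icc zero_le_one hcont ⟨by dsimp only; linarith, by dsimp only; linarith⟩
  dsimp only at hγ₀
  have hlow : n ≤ c * length F γ 0 t₀ := by
    refine le_trans ?_ (hF.norm_sub_le_length (h.mono le_rfl ht₀.1 ht₀.2))
    refine le_trans ?_ (abs_apply_le_norm _ 1)
    simp [hγ₀, h0', abs_of_nonneg hn]
  have hupp : n ≤ c * length F γ t₀ 1 := by
    refine le_trans ?_ (hF.norm_sub_le_length (h.mono ht₀.1 ht₀.2 le_rfl))
    refine le_trans ?_ (abs_apply_le_norm _ 1)
    simp [hγ₀, h1', abs_of_nonneg hn]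
  have hadd := hF.length_add h ht₀.1 ht₀.2
  have hex : ∀ τ, ∃ t, c * |τ| ≤ n → t ∈ Icc (0 : ℝ) 1 ∧
      length F γ 0 t = length F γ 0 t₀ + τ := by
    intro τ
    by_cases hτ : c * |τ| ≤ n
    · have h2 : |τ| ≤ length F γ 0 t₀ := le_of_mul_le_mul_left (hτ.trans hlow) hc
      have h3 : |τ| ≤ length F γ t₀ 1 := le_of_mul_le_mul_left (hτ.trans hupp) hc
      obtain ⟨t, ht, htl⟩ := hF.exists_length_eq h (τ := length F γ 0 t₀ + τ)
        (by linarith [neg_abs_le τ]) (by linarith [le_abs_self τ])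
      exact ⟨t, fun _ => ⟨ht, htl⟩⟩
    · exact ⟨0, fun h' => absurd h' hτ⟩
  choose θ hθ using hex
  have hlen : ∀ s t, 0 ≤ s → s ≤ t → t ≤ 1 →
      length F γ s t = length F γ 0 t - length F γ 0 s := by
    intro s t hs hst ht
    linarith [hF.length_add (h.mono le_rfl (hs.trans hst) ht) hs hst]
  -- A deck translation moves the crossing point into the segment `[0, 1) × {0}`.
  set m : ℤ := -⌊(γ t₀) 0⌋ with hm
  have hstart : ‖γ t₀ + (m : ℝ) • e₁‖ ≤ 1 := by
    refine (norm_le_abs_add_abs _).trans ?_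
    simp only [PiLp.add_apply, PiLp.smul_apply, smul_eq_mul, e₁_apply_zero, e₁_apply_one, mul_one, mul_zero, hγ₀, hm, Int.cast_neg,
      ← sub_eq_add_neg, Int.self_sub_floor, add_zero, abs_zero]
    rw [abs_of_nonneg (Int.fract_nonneg _)]
    exact (Int.fract_lt_one _).le
  refine ⟨fun τ => γ (θ τ) + (m : ℝ) • e₁, fun τ hτ => ?_, fun s t hs ht hst => ?_⟩
  · obtain ⟨hmem, hl⟩ := hθ τ hτ
    have h2 : ‖γ (θ τ) - γ t₀‖ ≤ c * |τ| := by
      rcases le_total (θ τ) t₀ with h3 | h3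
      · rw [norm_sub_rev]
        refine (hF.norm_sub_le_length (h.mono hmem.1 h3 ht₀.2)).trans ?_
        rw [hlen _ _ hmem.1 h3 ht₀.2, hl]
        exact mul_le_mul_of_nonneg_left (by linarith [neg_abs_le τ]) hc.le
      · refine (hF.norm_sub_le_length (h.mono ht₀.1 h3 hmem.2)).trans ?_
        rw [hlen _ _ ht₀.1 h3 hmem.2, hl]
        exact mul_le_mul_of_nonneg_left (by linarith [le_abs_self τ]) hc.le
    have h4 : γ (θ τ) + (m : ℝ) • e₁ = (γ t₀ + (m : ℝ) • e₁) + (γ (θ τ) - γ t₀) := by abel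
    dsimp only
    rw [h4]
    exact (norm_add_le _ _).trans (add_le_add hstart h2)
  · obtain ⟨hms, hls⟩ := hθ s hs
    obtain ⟨hmt, hlt⟩ := hθ t ht
    have hle : θ s ≤ θ t := by
      by_contra hcon
      push Not at hcon
      have h2 := hlen _ _ hmt.1 hcon.le hms.2
      have h3 := hF.length_nonneg (γ := γ) hcon.le
      have h4 : s = t := by linarith
      rw [h4] at hcon
      exact lt_irrefl _ hcon
    have hst' : length F γ (θ s) (θ t) = t - s := by
      rw [hlen _ _ hms.1 hle hmt.2]
      linarith
    constructor
    · rw [hF.dist_add_smul_e₁ hper, ← hst']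
      exact hF.dist_le_length (h.mono hms.1 hle hmt.2)
    · intro j
      have h2 := hmin _ _ hms.1 hle hmt.2 j
      dsimp only
      rwa [add_right_comm, hF.dist_add_smul_e₁ hper, ← hst']

/-- There is a distance-realising curve `ℝ → Plane` that remains minimal after adding the weight
`α` per deck translation. -/
theorem exists_isometry : ∃ σ : ℝ → Plane,
    (∀ s t, s ≤ t → dist F (σ s) (σ t) = t - s) ∧
    ∀ s t, s ≤ t → ∀ j : ℤ, t - s ≤ dist F (σ s) (σ t + (j : ℝ) • e₁) - α * j := by
  have hex := fun n : ℕ => hF.exists_almost_minimal_arc hper hα0 hα (n := n)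
    (δ := 1 / ((n : ℝ) + 1)) (Nat.cast_nonneg n) (by positivity)
  choose σ hbd hσ using hex
  -- An ultrafilter gives convergence at all parameters simultaneously, without a diagonal
  -- subsequence.
  set U : Ultrafilter ℕ := hyperfilter ℕ
  have hU : (U : Filter ℕ) ≤ atTop := Nat.hyperfilter_le_atTop
  have hev : ∀ τ : ℝ, ∀ᶠ n : ℕ in U, c * |τ| ≤ n := fun τ =>
    (tendsto_natCast_atTop_atTop.eventually_ge_atTop (c * |τ|)).filter_mono hU
  have hlim : ∀ τ, ∃ x, Tendsto (fun n => σ n τ) U (𝓝 x) := by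
    intro τ
    obtain ⟨x, -, hx⟩ := (isCompact_closedBall (0 : Plane) (1 + c * |τ|)).ultrafilter_le_nhds
      (U.map fun n => σ n τ) (by
        rw [le_principal_iff]
        refine (hev τ).mono fun n hn => ?_
        simpa using hbd n τ hn)
    exact ⟨x, hx⟩
  choose ρ hρ using hlim
  have hlow : ∀ s t, s ≤ t → ∀ j : ℤ, t - s ≤ dist F (ρ s) (ρ t + (j : ℝ) • e₁) - α * j := by
    intro s t hst j
    have h1 : Tendsto (fun n => dist F (σ n s) (σ n t + (j : ℝ) • e₁) - α * j) U
        (𝓝 (dist F (ρ s) (ρ t + (j : ℝ) • e₁) - α * j)) :=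
      ((hF.continuous_dist.tendsto _).comp
        ((hρ s).prodMk_nhds ((hρ t).add_const _))).sub_const _
    have h2 : Tendsto (fun n : ℕ => t - s - 1 / ((n : ℝ) + 1)) U (𝓝 (t - s)) := by
      simpa using ((tendsto_one_div_add_atTop_nhds_zero_nat (𝕜 := ℝ)).mono_left hU).const_sub (t - s)
    refine le_of_tendsto_of_tendsto h2 h1 ?_
    filter_upwards [hev s, hev t] with n hs ht
    exact (hσ n s t hs ht hst).2 j
  refine ⟨ρ, fun s t hst => le_antisymm ?_ (by simpa using hlow s t hst 0), hlow⟩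
  have h1 : Tendsto (fun n => dist F (σ n s) (σ n t)) U (𝓝 (dist F (ρ s) (ρ t))) :=
    (hF.continuous_dist.tendsto _).comp ((hρ s).prodMk_nhds (hρ t))
  refine le_of_tendsto h1 ?_
  filter_upwards [hev s, hev t] with n hs ht
  exact (hσ n s t hs ht hst).1

omit hper hα0 hα in
/-- Linear horizontal drift of weighted minimal curves. -/
theorem horizontal_drift (hc : c ≤ 1.016) {σ : ℝ → Plane}
    (hσ : ∀ s t, s ≤ t → dist F (σ s) (σ t) = t - s)
    (hmin : ∀ s t, s ≤ t → ∀ j : ℤ, t - s ≤ dist F (σ s) (σ t + (j : ℝ) • e₁) - 9 / 10 * j)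
    {s t : ℝ} (hst : s ≤ t) : 1 / 2 * (t - s) - 2 ≤ (σ t) 0 - (σ s) 0 := by
  have hc0 := hF.pos
  set a := (σ t) 0 - (σ s) 0 with ha
  set b := |(σ t) 1 - (σ s) 1| with hb
  have hb0 : 0 ≤ b := abs_nonneg _
  have hbT : b ≤ 1.016 * (t - s) := by
    have h1 : b ≤ ‖σ t - σ s‖ := abs_apply_le_norm (σ t - σ s) 1
    have h2 := hF.norm_sub_le_of_isometry hσ hst
    have h3 : c * (t - s) ≤ 1.016 * (t - s) := mul_le_mul_of_nonneg_right hc (by linarith)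
    linarith
  -- The shifted chord has horizontal extent about `2 * b` and height `b`. The ratio 2 nearly
  -- minimises `1.016 * √(1 + m ^ 2) - 0.9 * m` over `m`, and `2.237` below exceeds `√5`.
  set j : ℤ := ⌈2 * b - a⌉ with hj
  have hj1 : 2 * b - a ≤ j := Int.le_ceil _
  have hj2 : (j : ℝ) < 2 * b - a + 1 := Int.ceil_lt_add_one _
  have hnorm : ‖σ t + (j : ℝ) • e₁ - σ s‖ ≤ 2.237 * b + 1 := by
    rw [EuclideanSpace.norm_eq, Fin.sum_univ_two]
    refine Real.sqrt_le_iff.2 ⟨by positivity, ?_⟩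
    have h0 : (σ t + (j : ℝ) • e₁ - σ s) 0 = a + j := by
      simp only [PiLp.sub_apply, PiLp.add_apply, PiLp.smul_apply, smul_eq_mul, e₁_apply_zero, mul_one, ha]
      ring
    have h1 : (σ t + (j : ℝ) • e₁ - σ s) 1 = (σ t) 1 - (σ s) 1 := by
      simp only [PiLp.sub_apply, PiLp.add_apply, PiLp.smul_apply, smul_eq_mul, e₁_apply_one, mul_zero]
      ring
    rw [h0, h1, Real.norm_eq_abs, Real.norm_eq_abs, ← hb, sq_abs]
    have h2 : (a + j) ^ 2 ≤ (2 * b + 1) ^ 2 :=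
      pow_le_pow_left₀ (by linarith) (by linarith) 2
    nlinarith
  have h1 := hmin s t hst j
  have h2 := hF.dist_le_norm (σ s) (σ t + (j : ℝ) • e₁)
  have h3 : c * ‖σ t + (j : ℝ) • e₁ - σ s‖ ≤ 1.016 * (2.237 * b + 1) :=
    mul_le_mul hc hnorm (norm_nonneg _) (by norm_num)
  linarith

end IsPinched

/-! ### Return to the cylinder -/

theorem proj_add_intCast_smul_e₁ (x : Plane) (k : ℤ) : proj (x + (k : ℝ) • e₁) = proj x := by
  ext
  · simp [proj]
  · simp [proj]

theorem isPinched_lift {F : Cylinder → Plane → ℝ} {c : ℝ} (hF : IsFinslerMetricOnCylinder F)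
    (hc : 1 ≤ c) (h : ∀ p v, 1 / c * ‖v‖ ≤ F p v ∧ F p v ≤ c * ‖v‖) : IsPinched (lift F) c where
  finsler := hF
  one_le := hc
  lower x v := by
    have h1 := (h (proj x) v).1
    rwa [one_div, inv_mul_le_iff₀ (by linarith)] at h1
  upper x v := (h (proj x) v).2

theorem integral_inner_deriv_e₁ {γ : ℝ → Plane} (h : ContDiff ℝ 1 γ) (a b : ℝ) :
    ∫ t in a..b, inner ℝ (deriv γ t) e₁ = (γ b) 0 - (γ a) 0 := by
  have hinner : ∀ x : Plane, inner ℝ x e₁ = x 0 := by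
    intro x
    simp [PiLp.inner_apply, Fin.sum_univ_two]
  have hd : ∀ t, HasDerivAt (fun t => (γ t) 0) ((deriv γ t) 0) t := fun t =>
    (EuclideanSpace.proj (𝕜 := ℝ) (0 : Fin 2)).hasFDerivAt.comp_hasDerivAt t
      ((h.differentiable one_ne_zero) t).hasDerivAt
  simp only [hinner]
  refine intervalIntegral.integral_eq_sub_of_hasDerivAt (fun t _ => hd t) ?_
  exact ((EuclideanSpace.proj (𝕜 := ℝ) (0 : Fin 2)).continuous.comp
    (h.continuous_deriv le_rfl)).intervalIntegrable _ _

/-- The upper bound on `f` is needed because a real `liminf` takes a default value when the eventual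
lower bounds are unbounded. For `T ≥ 8` the loss `2 / T` is at most `1 / 4`. -/
theorem le_liminf_average {f : ℝ → ℝ} {c : ℝ} (hlow : ∀ T, 0 ≤ T → 1 / 2 * T - 2 ≤ f T)
    (hupp : ∀ T, 0 ≤ T → f T ≤ c * T) : 1 / 4 ≤ liminf (fun T => 1 / T * f T) atTop := by
  have hb : IsBoundedUnder (· ≤ ·) atTop fun T => 1 / T * f T := by
    refine isBoundedUnder_of_eventually_le (a := c) ?_
    filter_upwards [eventually_gt_atTop 0] with T hT
    rw [one_div, inv_mul_le_iff₀ hT, mul_comm]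
    exact hupp T hT.le
  refine le_liminf_of_le hb.isCoboundedUnder_ge ?_
  filter_upwards [eventually_ge_atTop 8] with T hT
  have hT0 : 0 < T := by linarith
  rw [one_div T, ← div_eq_inv_mul, le_div_iff₀ hT0]
  linarith [hlow T hT0.le]

end CylinderFinsler

theorem mainTheorem1 (cF : ℝ) (h1 : 1 ≤ cF) (h2 : cF ≤ 1.016) :
    ∃ ε : ℝ, 0 < ε ∧
      ∀ F : CylinderFinsler.Cylinder → CylinderFinsler.Plane → ℝ,
        CylinderFinsler.IsFinslerMetricOnCylinder F →
        (∀ p v, 1 / cF * ‖v‖ ≤ F p v ∧ F p v ≤ cF * ‖v‖) →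
        ∃ (c : ℝ → CylinderFinsler.Cylinder) (γ : ℝ → CylinderFinsler.Plane),
          CylinderFinsler.IsMinimalGeodesicWithLift F c γ ∧
          ε ≤ Filter.liminf
            (fun T : ℝ => 1 / T * ∫ t in (-T)..0, inner ℝ (deriv γ t) CylinderFinsler.e₁)
            Filter.atTop ∧
          ε ≤ Filter.liminf
            (fun T : ℝ => 1 / T * ∫ t in (0 : ℝ)..T, inner ℝ (deriv γ t) CylinderFinsler.e₁)
            Filter.atTop := by
  refine ⟨1 / 4, by norm_num, fun F hFinsler hbounds => ?_⟩
  have hF := CylinderFinsler.isPinched_lift hFinsler h1 hbounds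
  -- The weight `9 / 10` is admissible since `1.016 * 0.9 < 1`.
  obtain ⟨σ, hσ, hmin⟩ := hF.exists_isometry
    (fun k x v => congrArg (F · v) (CylinderFinsler.proj_add_intCast_smul_e₁ x k))
    (α := 9 / 10) (by norm_num) (by norm_num at h2 ⊢; linarith)
  have hgeo := hF.isMinimalGeodesic_of_isometry hσ
  have hupp : ∀ s t, s ≤ t → (σ t) 0 - (σ s) 0 ≤ cF * (t - s) := fun s t hst =>
    (le_abs_self _).trans ((CylinderFinsler.abs_apply_le_norm (σ t - σ s) 0).trans
      (hF.norm_sub_le_of_isometry hσ hst))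
  refine ⟨fun t => CylinderFinsler.proj (σ t), σ, ⟨fun _ => rfl, hgeo⟩, ?_, ?_⟩
  · refine CylinderFinsler.le_liminf_average (c := cF) (fun T hT => ?_) (fun T hT => ?_)
    · rw [CylinderFinsler.integral_inner_deriv_e₁ hgeo.contDiff]
      simpa using hF.horizontal_drift h2 hσ hmin (neg_nonpos.2 hT)
    · rw [CylinderFinsler.integral_inner_deriv_e₁ hgeo.contDiff]
      simpa using hupp (-T) 0 (neg_nonpos.2 hT)
  · refine CylinderFinsler.le_liminf_average (c := cF) (fun T hT => ?_) (fun T hT => ?_)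
    · rw [CylinderFinsler.integral_inner_deriv_e₁ hgeo.contDiff]
      simpa using hF.horizontal_drift h2 hσ hmin hT
    · rw [CylinderFinsler.integral_inner_deriv_e₁ hgeo.contDiff]
      simpa using hupp 0 T hT
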